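/- Let $S=S^1\times[0,1]$ be the annulus, realised as $\{z\in\mathbb{C}: 1\le |z|\le 2\}$ via $(u,t)\mapsto(1+t)u$ and oriented as a subset of the plane. A \emph{foliation} on $S$ is a section $\eta$ of the projectivized tangent bundle $\mathbb{P}(TS)$; foliations are considered up to homotopy of sections. A \emph{marking} of $S$ is a subset $M\subset\partial S$ which on each of the two boundary circles is either the whole circle or a union of $n\ge 1$ disjoint open intervals separated by non-degenerate unmarked intervals. An \emph{arc} in $(S,M)$ is a smoothly embedded closed interval which meets $\partial S$ exactly in its endpoints, transversely and in $M$, and is not isotopic to an interval in $M$. A \emph{boundary path} from an arc $X$ to an arc $Y$ is a non-constant path in $M$ from an endpoint of $X$ to an endpoint of $Y$ which follows the reversed boundary orientation. A \emph{grading} of an immersed curve $\gamma$ is a continuous choice of homotopy classes of paths $\tilde\gamma$ in the fibres of $\mathbb{P}(TS)$ from the tangent line of $\gamma$ to $\eta$. For graded curves meeting transversely at $p$, the index $i_p(\gamma_1,\gamma_2)\in\pi_1(\mathbb{P}(T_pS),\eta_p)\cong\mathbb{Z}$ is the class of the loop which runs from $\eta_p$ backwards along $\tilde\gamma_1(p)$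 to $\dot\gamma_1$, then along the shortest counterclockwise path to $\dot\gamma_2$, then along $\tilde\gamma_2(p)$ to $\eta_p$. The \emph{degree} of a boundary path $\gamma$ from $X$ to $Y$ is $|\gamma|=i_{\gamma(0)}(X,\gamma)-i_{\gamma(1)}(Y,\gamma)$. A \emph{double pair} consists of two disjoint arcs $X,Y$ and two distinct boundary paths $\gamma,\gamma'$ from $X$ to $Y$ which start at the same end of $X$ if and only if they finish at the same end of $Y$ (this condition is automatic if $M=\partial S$). The foliation $\eta$ is \emph{balanced} for $M$ if $|\gamma|=|\gamma'|$ for every double pair and all gradings of $X$ and $Y$. Then there is exactly one balanced foliation on the annulus up to homotopy. More precisely, there is a homotopy class $c$ of foliations such that for every foliation $\eta$: (1) for every marking $M$ of $S$, $\eta$ is balanced for $M$ if and only if $\eta\in c$; (2) the winding number $\eta\ast\gamma$ of the tangent line of $\gamma$ relative to $\eta$ vanishes for all smooth embedded closed curves $\gamma$ in $S$ that are not null-homotopic if and only if $\eta\in c$; (3) the map $S^1\to S^1$ obtained by restricting $\eta$ to $S^1\times\{0\}$ under the rotation-invariant trivialization $\mathbb{P}(TS)\cong S\times\mathbb{P}(\mathbb{R}^2)\cong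 S\times S^1$ has degree $0$ if and only if $\eta\in c$. -/

import Mathlib

open Set Topology
open scoped ContDiff LinearAlgebra.Projectivization

noncomputable section

namespace AnnulusFoliation

/-! ### The annulus and its foliations -/

/-- The annulus `S = S¹ × [0,1]`, realised as the planar domain `1 ≤ ‖z‖ ≤ 2` through
`(u, t) ↦ (1 + t) u`. It carries the orientation of the plane, and its tangent space at every
point (boundary points included) is `ℂ`. -/
def annulus : Set ℂ := {z | 1 ≤ ‖z‖ ∧ ‖z‖ ≤ 2}

/-- The real projective line of lines in `ℂ = ℝ²`, with the quotient topology of `ℂ \ {0}`. -/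
instance lineTopology : TopologicalSpace (ℙ ℝ ℂ) :=
  inferInstanceAs (TopologicalSpace (Quotient (projectivizationSetoid ℝ ℂ)))

/-- A foliation (line field): a section of `P(TS)`. As `T_z S = ℂ` for a planar domain, the fibre
of `P(TS)` over every `z` is `ℙ ℝ ℂ`. -/
abbrev Foliation : Type := C(annulus, ℙ ℝ ℂ)

/-- The set `π₀ Γ(S, P(TS))` of homotopy classes of foliations. -/
def FoliationClass : Type :=
  Quotient (⟨ContinuousMap.Homotopic, ContinuousMap.Homotopic.equivalence⟩ : Setoid Foliation)

/-- The homotopy class of a foliation. -/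
def Foliation.toClass (η : Foliation) : FoliationClass := Quotient.mk _ η

/-! ### The trivialization `P(TS) ≅ S × S¹` and the degree -/

/-- The homeomorphism `P(ℝ²) ≅ S¹`, `[v] ↦ v² / ‖v‖² = v / conj v`. -/
def lineToCircle : ℙ ℝ ℂ → Circle :=
  Projectivization.lift (fun v => (Circle.ofConjDivSelf v.1 v.2)⁻¹) (by
    rintro ⟨a, ha⟩ ⟨b, hb⟩ t h
    have ht : t ≠ 0 := by
      rintro rfl
      exact ha (by simpa using h)
    have ht' : (t : ℂ) ≠ 0 := by exact_mod_cast ht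
    have hab : a = (t : ℂ) * b := by simpa using h
    subst hab
    congr 1
    ext
    simp only [Circle.ofConjDivSelf, map_mul, Complex.conj_ofReal]
    exact mul_div_mul_left _ _ ht')

/-- The rotation-invariant trivialization of the tangent spaces of the annulus at a point `z ≠ 0`:
the tangent vector `v` has the coordinate `v / (i z)`, so the tangent vector `i z` of the circle
direction has the coordinate `1`, and the inward radial vector `- z` the coordinate `i`. -/
def frameCoord (z : ℂ) : ℂ →ₗ[ℝ] ℂ := LinearMap.mulLeft ℝ (Complex.I * z)⁻¹

lemma frameCoord_injective {z : ℂ} (hz : z ≠ 0) : Function.Injective (frameCoord z) := by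
  have h : (Complex.I * z)⁻¹ ≠ 0 := inv_ne_zero (mul_ne_zero Complex.I_ne_zero hz)
  exact fun a b hab => mul_left_cancel₀ h hab

lemma ne_zero_of_mem_annulus {z : ℂ} (hz : z ∈ annulus) : z ≠ 0 := by
  rintro rfl
  have := hz.1
  norm_num at this

/-- The trivialization `P(TS) ≅ S × P(ℝ²) ≅ S × S¹` induced by the frame. -/
def trivialization (p : annulus × ℙ ℝ ℂ) : annulus × Circle :=
  (p.1, lineToCircle (Projectivization.map (frameCoord p.1)
    (frameCoord_injective (ne_zero_of_mem_annulus p.1.2)) p.2))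

/-- The inclusion of `S¹` as `S¹ × {0}` in the annulus. -/
def innerCircle (u : Circle) : annulus :=
  ⟨(u : ℂ), by constructor <;> rw [Circle.norm_coe]; norm_num⟩

/-- The self-map of the circle that corresponds to a foliation: the foliation is a map `S → S¹`
under the trivialization, and `S` is homotopy equivalent to `S¹ × {0}`. -/
def Foliation.circleMap (η : Foliation) (u : Circle) : Circle :=
  (trivialization (innerCircle u, η (innerCircle u))).2

/-- A self-map of the circle has degree `d`: it has a continuous lift `F` to the universal cover
with `F (t + 2π) = F t + 2π d`. -/
def HasDegree (f : Circle → Circle) (d : ℤ) : Prop :=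
  ∃ F : ℝ → ℝ, Continuous F ∧ (∀ t, f (Circle.exp t) = Circle.exp (F t)) ∧
    ∀ t, F (t + 2 * Real.pi) = F t + d * (2 * Real.pi)

/-! ### Curves, gradings and intersection indices -/

/-- The velocity of a curve parametrized by `[0,1]`. -/
def velocity (γ : ℝ → ℂ) (t : ℝ) : ℂ := derivWithin γ (Icc 0 1) t

/-- A smooth immersed curve `[0,1] → S`. Values of `γ` outside `[0,1]` are irrelevant. -/
structure IsImmersedCurve (γ : ℝ → ℂ) : Prop where
  smooth : ContDiffOn ℝ ∞ γ (Icc 0 1)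
  mem : ∀ t ∈ Icc (0 : ℝ) 1, γ t ∈ annulus
  immersed : ∀ t ∈ Icc (0 : ℝ) 1, velocity γ t ≠ 0

/-- A grading of an immersed curve: a continuous choice of (homotopy classes of) paths in
`P(T_{γ t} S)` from the tangent line of `γ` to the line of `η`. The homotopy class of such a path
is given by its total counterclockwise angle `a t`. -/
def IsGrading (η : Foliation) (γ : ℝ → ℂ) (a : ℝ → ℝ) : Prop :=
  ContinuousOn a (Icc 0 1) ∧ ∀ t ∈ Icc (0 : ℝ) 1, ∀ h : γ t ∈ annulus,
    Complex.exp (a t * Complex.I) * velocity γ t ∈ (η ⟨γ t, h⟩).submodule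

/-- The angle in `[0, π)` of the shortest counterclockwise rotation taking the line `ℝ v` to the
line `ℝ w`; it lies in `(0, π)` if the lines are distinct. -/
def ccwAngle (v w : ℂ) : ℝ := toIcoMod Real.pi_pos 0 (Complex.arg (w / v))

/-- The intersection index of two graded curves that meet transversely at a point, with velocities
`v₁, v₂` and gradings `a₁, a₂` there. The loop in `P(T_p S)` based at `η_p` goes to the first line
(angle `- a₁`), from there counterclockwise to the second line, and back to `η_p` (angle `a₂`);
its class in `π₁ ≅ ℤ` is its total angle divided by `π`, always an integer. -/
def intersectionIndex (v₁ v₂ : ℂ) (a₁ a₂ : ℝ) : ℝ := (-a₁ + ccwAngle v₁ v₂ + a₂) / Real.pi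

/-! ### Markings, arcs and boundary paths -/

/-- A marking of the circle of radius `r`: the whole circle if it has no corners, and otherwise
`n ≥ 1` disjoint open intervals separated by non-degenerate unmarked intervals; the corners are
the endpoints of these intervals. -/
def IsCircleMarking (r : ℝ) (M : Set ℂ) : Prop :=
  M = {z | ‖z‖ = r} ∨
  ∃ (n : ℕ) (a b : Fin n → ℝ), 0 < n ∧ (∀ i, a i < b i) ∧ (∀ i j, i < j → b i < a j) ∧
    (∀ i j, b i < a j + 2 * Real.pi) ∧
    M = {z | ∃ i, ∃ θ ∈ Ioo (a i) (b i), z = r * Complex.exp (θ * Complex.I)}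

/-- A marking of the annulus. -/
def IsMarking (M : Set ℂ) : Prop :=
  ∃ M₁ M₂ : Set ℂ, IsCircleMarking 1 M₁ ∧ IsCircleMarking 2 M₂ ∧ M = M₁ ∪ M₂

/-- A curve with endpoints in `M` can be deformed into `M`, the endpoints staying in `M`. For
embedded curves this is the same as being isotopic to an interval in `M`. -/
def DeformsInto (M : Set ℂ) (X : ℝ → ℂ) : Prop :=
  ∃ H : ℝ × ℝ → ℂ, ContinuousOn H (Icc 0 1 ×ˢ Icc 0 1) ∧
    (∀ s ∈ Icc (0 : ℝ) 1, ∀ t ∈ Icc (0 : ℝ) 1, H (s, t) ∈ annulus) ∧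
    (∀ t ∈ Icc (0 : ℝ) 1, H (0, t) = X t) ∧
    (∀ s ∈ Icc (0 : ℝ) 1, H (s, 0) ∈ M ∧ H (s, 1) ∈ M) ∧
    (∀ t ∈ Icc (0 : ℝ) 1, H (1, t) ∈ M)

/-- An arc in the marked annulus: an embedded closed interval that meets the boundary exactly at
its endpoints, transversely and in `M`, and that is not isotopic to an interval in `M`. The
boundary has the tangent vector `i z` at `z`. -/
structure IsArc (M : Set ℂ) (X : ℝ → ℂ) : Prop extends IsImmersedCurve X where
  injOn : InjOn X (Icc 0 1)
  interior : ∀ t ∈ Ioo (0 : ℝ) 1, 1 < ‖X t‖ ∧ ‖X t‖ < 2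
  endpoints : X 0 ∈ M ∧ X 1 ∈ M
  transverse : ∀ t, t = 0 ∨ t = 1 → ∀ c : ℝ, velocity X t ≠ c * (Complex.I * X t)
  essential : ¬ DeformsInto M X

/-- The direction of the reversed boundary orientation at a boundary point: the surface lies to
its right. It is counterclockwise on the inner circle and clockwise on the outer circle. -/
def reverseBoundary (z : ℂ) : ℂ := if ‖z‖ = 1 then Complex.I * z else -(Complex.I * z)

/-- A non-trivial boundary path from `X` to `Y`: a path in `M` along the reversed boundary
orientation from the endpoint `X s` of `X` to the endpoint `Y t` of `Y`, where `s, t ∈ {0, 1}`. -/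
structure IsBoundaryPath (M : Set ℂ) (X Y : ℝ → ℂ) (γ : ℝ → ℂ) (s t : ℝ) : Prop
    extends IsImmersedCurve γ where
  mem_marking : ∀ u ∈ Icc (0 : ℝ) 1, γ u ∈ M
  direction : ∀ u ∈ Icc (0 : ℝ) 1, ∃ c : ℝ, 0 < c ∧ velocity γ u = c * reverseBoundary (γ u)
  source : s = 0 ∨ s = 1
  target : t = 0 ∨ t = 1
  start : γ 0 = X s
  finish : γ 1 = Y t

/-- The degree `i_{γ(0)}(X, γ) - i_{γ(1)}(Y, γ)` of a boundary path from `X s` to `Y t`, for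
gradings `x, y, g` of `X, Y, γ`. -/
def pathDegree (X Y γ : ℝ → ℂ) (s t : ℝ) (x y g : ℝ → ℝ) : ℝ :=
  intersectionIndex (velocity X s) (velocity γ 0) (x s) (g 0) -
    intersectionIndex (velocity Y t) (velocity γ 1) (y t) (g 1)

/-- A double pair: two disjoint arcs `X, Y` and two distinct non-trivial boundary paths `γ, γ'`
from `X` to `Y` that close up to a loop, either with each other (same ends of `X` and of `Y`, which
needs a boundary circle in `M`) or with both arcs (`X · γ · Y · γ'⁻¹`, different ends of `X` and of
`Y`). -/
structure IsDoublePair (M : Set ℂ) (X Y γ γ' : ℝ → ℂ) (s t s' t' : ℝ) : Prop where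
  arc_left : IsArc M X
  arc_right : IsArc M Y
  disjoint : Disjoint (X '' Icc 0 1) (Y '' Icc 0 1)
  path : IsBoundaryPath M X Y γ s t
  path' : IsBoundaryPath M X Y γ' s' t'
  distinct : ∃ u ∈ Icc (0 : ℝ) 1, γ u ≠ γ' u
  loop : s = s' ↔ t = t'

/-- A foliation is balanced for the marking `M` if in every double pair both boundary paths have
the same degree. -/
def IsBalanced (M : Set ℂ) (η : Foliation) : Prop :=
  ∀ (X Y γ γ' : ℝ → ℂ) (s t s' t' : ℝ), IsDoublePair M X Y γ γ' s t s' t' →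
    ∀ x y g g' : ℝ → ℝ, IsGrading η X x → IsGrading η Y y → IsGrading η γ g → IsGrading η γ' g' →
      pathDegree X Y γ s t x y g = pathDegree X Y γ' s' t' x y g'

/-! ### Closed curves -/

/-- A closed curve (with period `1`) is null-homotopic in the annulus. -/
def IsNullhomotopic (γ : ℝ → ℂ) : Prop :=
  ∃ H : ℝ × ℝ → ℂ, ContinuousOn H (Icc 0 1 ×ˢ Icc 0 1) ∧
    (∀ s ∈ Icc (0 : ℝ) 1, ∀ t ∈ Icc (0 : ℝ) 1, H (s, t) ∈ annulus) ∧
    (∀ t ∈ Icc (0 : ℝ) 1, H (0, t) = γ t) ∧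
    (∀ s ∈ Icc (0 : ℝ) 1, H (s, 0) = H (s, 1)) ∧
    (∀ t ∈ Icc (0 : ℝ) 1, H (1, t) = H (1, 0))

/-- A smooth embedded closed curve in the annulus that is unobstructed, that is, does not bound a
disk. -/
structure IsUnobstructedClosedCurve (γ : ℝ → ℂ) : Prop where
  smooth : ContDiff ℝ ∞ γ
  periodic : Function.Periodic γ 1
  mem : ∀ t, γ t ∈ annulus
  immersed : ∀ t, deriv γ t ≠ 0
  injOn : InjOn γ (Ico 0 1)
  not_nullhomotopic : ¬ IsNullhomotopic γ

/-- `η ∗ γ = 0` for all unobstructed embedded closed curves `γ`. Here `η ∗ γ` is the winding number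
of the tangent line of `γ` around `η`: for a grading `a` along one period it is
`(a 0 - a 1) / π`. -/
def WindsTrivially (η : Foliation) : Prop :=
  ∀ γ : ℝ → ℂ, IsUnobstructedClosedCurve γ → ∀ a : ℝ → ℝ, IsGrading η γ a →
    (a 0 - a 1) / Real.pi = 0

end AnnulusFoliation

end

/-!
In the logarithmic coordinate `w` with `z = e ^ w` the circle direction `i z` is vertical, and a
foliation has an angle `ψ w` against it, with `ψ (w + 2πi) = ψ w + d π`. The integer `d` is the only
homotopy invariant and equals the degree in (3). The core circle has winding number `± d`, and two
disjoint spirals crossing the annulus, together with a boundary path on each circle, form a double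
pair whose degrees differ by `± d`; hence each of the three conditions forces `d = 0`.

Conversely, for `d = 0` the angle is a function `Ψ` on the annulus, and a grading of a curve is
`Ψ` minus a continuous angle of the velocity of the curve in the coordinate `w`, up to a constant.
The total turning of this velocity follows from Hopf's secant argument for embedded curves: it is
`0` for a closed curve that advances by `2πi`; for an arc crossing the strip `0 ≤ re w ≤ log 2` it
is the difference of the principal arguments at the ends; and for an arc returning to its boundary
circle there is an additional half turn, whose sign tells which end is the lower one. As both arcs
of a double pair are essential, a boundary path from the lower end of a returning arc to a disjoint
returning arc must reach the lower end, since otherwise the ends would interleave and the arcs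
intersect. So the half turns of both arcs cancel in the comparison of the degrees.
-/

namespace AnnulusFoliation

open Complex (I arg exp)
open Real (pi_pos)
open scoped Real

/-! ### Continuous logarithms -/

section Convex

variable {E : Type*} [NormedAddCommGroup E] [NormedSpace ℝ E] {K : Set E}

lemma exists_log_of_convex (hK : Convex ℝ K) (hne : K.Nonempty) {f : E → ℂ}
    (hf : ContinuousOn f K) (h0 : ∀ a ∈ K, f a ≠ 0) :
    ∃ L : E → ℂ, ContinuousOn L K ∧ ∀ a ∈ K, exp (L a) = f a := by
  have := hK.contractibleSpace hne
  have := hK.locallyPathConnectedSpace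
  obtain ⟨a₀, ha₀⟩ := hne
  obtain ⟨L, ⟨-, hL⟩, -⟩ := Complex.isCoveringMapOn_exp.existsUnique_continuousMap_lifts
    ⟨K.domRestrict f, hf.domRestrict⟩ (a₀ := ⟨a₀, ha₀⟩) (Complex.exp_log (h0 a₀ ha₀))
    (fun a => h0 a a.2)
  have hext (a : K) : Function.extend Subtype.val L 0 (a : E) = L a :=
    Subtype.val_injective.extend_apply L 0 a
  refine ⟨Function.extend Subtype.val L 0, continuousOn_iff_continuous_domRestrict.2 <|
    L.continuous.congr fun a => (hext a).symm, fun a ha => ?_⟩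
  rw [hext ⟨a, ha⟩]
  exact congrFun hL ⟨a, ha⟩

lemma exists_angle_of_convex (hK : Convex ℝ K) (hne : K.Nonempty) {f : E → Circle}
    (hf : ContinuousOn f K) :
    ∃ φ : E → ℝ, ContinuousOn φ K ∧ ∀ a ∈ K, Circle.exp (φ a) = f a := by
  obtain ⟨L, hL, hexp⟩ := exists_log_of_convex hK hne (f := fun a => (f a : ℂ))
    (by fun_prop) (fun a _ => (f a).coe_ne_zero)
  refine ⟨fun a => (L a).im, by fun_prop, fun a ha => Circle.ext ?_⟩
  have hre : (L a).re = 0 := by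
    rw [← Real.exp_eq_one_iff, ← Complex.norm_exp, hexp a ha, Circle.norm_coe]
  rw [Circle.coe_exp, ← hexp a ha, ← Complex.re_add_im (L a), hre]
  simp

end Convex

section Preconnected

variable {A : Type*} [TopologicalSpace A] {S : Set A} {x y : A}

lemma eq_of_forall_mem_zmultiples {E : Type*} [NormedAddCommGroup E] [NormedSpace ℚ E]
    (hS : IsPreconnected S) {f : A → E} (hf : ContinuousOn f S) {p : E}
    (h : ∀ a ∈ S, f a ∈ AddSubgroup.zmultiples p) (hx : x ∈ S) (hy : y ∈ S) : f x = f y :=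
  hS.constant_of_mapsTo ⟨NormedSpace.discreteTopology_zmultiples p⟩ hf h hx hy

variable {L L' f : A → ℂ}

lemma sub_eq_sub_of_exp_eq_exp (hS : IsPreconnected S) (hL : ContinuousOn L S)
    (hL' : ContinuousOn L' S) (h : ∀ a ∈ S, exp (L a) = exp (L' a)) (hx : x ∈ S) (hy : y ∈ S) :
    L x - L' x = L y - L' y := by
  refine eq_of_forall_mem_zmultiples hS (hL.sub hL') (p := 2 * π * I) (fun a ha => ?_) hx hy
  obtain ⟨n, hn⟩ := Complex.exp_eq_exp_iff_exists_int.1 (h a ha)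
  exact ⟨n, by simp [hn]⟩

lemma im_sub_im_of_mem_slitPlane (hS : IsPreconnected S) (hL : ContinuousOn L S)
    (hf : ∀ a ∈ S, exp (L a) = f a) (h : ∀ a ∈ S, f a ∈ Complex.slitPlane)
    (hx : x ∈ S) (hy : y ∈ S) : (L x).im - (L y).im = arg (f x) - arg (f y) := by
  have hcont : ContinuousOn f S := hL.cexp.congr fun a ha => (hf a ha).symm
  have := congrArg Complex.im <| sub_eq_sub_of_exp_eq_exp hS hL (hcont.clog h)
    (fun a ha => by rw [hf a ha, Complex.exp_log (Complex.slitPlane_ne_zero (h a ha))]) hx hy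
  simp only [Complex.sub_im, Complex.log_im] at this
  linarith

lemma im_sub_im_of_re_nonneg (hS : IsPreconnected S) (hL : ContinuousOn L S)
    (hf : ∀ a ∈ S, exp (L a) = f a) (h : ∀ a ∈ S, 0 ≤ (f a).re)
    (hx : x ∈ S) (hy : y ∈ S) : (L x).im - (L y).im = arg (f x) - arg (f y) := by
  refine im_sub_im_of_mem_slitPlane hS hL hf (fun a ha => ?_) hx hy
  refine (h a ha).lt_or_eq.imp_right fun hre him => Complex.exp_ne_zero (L a) ?_
  rw [hf a ha]
  exact Complex.ext hre.symm him

lemma im_sub_im_of_re_nonpos (hS : IsPreconnected S) (hL : ContinuousOn L S)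
    (hf : ∀ a ∈ S, exp (L a) = f a) (h : ∀ a ∈ S, (f a).re ≤ 0)
    (hx : x ∈ S) (hy : y ∈ S) : (L x).im - (L y).im = arg (-f x) - arg (-f y) := by
  have := im_sub_im_of_re_nonneg hS (L := fun a => L a + π * I) (f := fun a => -f a) (by fun_prop)
    (fun a ha => by rw [Complex.exp_add_pi_mul_I, hf a ha]) (fun a ha => by simpa using h a ha)
    hx hy
  simpa using this

end Preconnected

/-! ### Planarity -/

lemma exists_eq_of_interleaved {α β : ℝ → ℂ} (hα : ContinuousOn α (Icc 0 1))
    (hβ : ContinuousOn β (Icc 0 1)) (hα' : ∀ s ∈ Icc (0 : ℝ) 1, 0 ≤ (α s).re)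
    (hβ' : ∀ t ∈ Icc (0 : ℝ) 1, 0 ≤ (β t).re) (hα0 : (α 0).re = 0) (hα1 : (α 1).re = 0)
    (hβ0 : (β 0).re = 0) (hβ1 : (β 1).re = 0) (h₁ : (α 0).im < (β 0).im)
    (h₂ : (β 0).im < (α 1).im) (h₃ : (α 1).im < (β 1).im) :
    ∃ s ∈ Icc (0 : ℝ) 1, ∃ t ∈ Icc (0 : ℝ) 1, α s = β t := by
  by_contra! hne
  have h0 : (0 : ℝ) ∈ Icc (0 : ℝ) 1 := unitInterval.zero_mem
  have h1 : (1 : ℝ) ∈ Icc (0 : ℝ) 1 := unitInterval.one_mem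
  obtain ⟨L, hL, hexp⟩ := exists_log_of_convex ((convex_Icc (0 : ℝ) 1).prod (convex_Icc (0 : ℝ) 1))
    ⟨(0, 0), h0, h0⟩
    (f := fun p => α p.1 - β p.2)
    ((hα.comp continuousOn_fst fun p hp => hp.1).sub (hβ.comp continuousOn_snd fun p hp => hp.2))
    (fun p hp => sub_ne_zero.2 (hne _ hp.1 _ hp.2))
  have vert {s : ℝ} (hs : s ∈ Icc (0 : ℝ) 1) (hre : (α s).re = 0) :
      (L (s, 1)).im - (L (s, 0)).im = arg (β 1 - α s) - arg (β 0 - α s) := by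
    have := im_sub_im_of_re_nonpos isPreconnected_Icc (L := fun t => L (s, t))
      (hL.comp (by fun_prop) fun t ht => ⟨hs, ht⟩) (fun t ht => hexp _ ⟨hs, ht⟩)
      (fun t ht => by simpa [hre] using hβ' t ht) h1 h0
    simpa only [neg_sub] using this
  have horiz {t : ℝ} (ht : t ∈ Icc (0 : ℝ) 1) (hre : (β t).re = 0) :
      (L (1, t)).im - (L (0, t)).im = arg (α 1 - β t) - arg (α 0 - β t) :=
    im_sub_im_of_re_nonneg isPreconnected_Icc (L := fun s => L (s, t))
      (hL.comp (by fun_prop) fun s hs => ⟨hs, ht⟩) (fun s hs => hexp _ ⟨hs, ht⟩)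
      (fun s hs => by simpa [hre] using hα' s hs) h1 h0
  have up {z w : ℂ} (hz : z.re = 0) (hw : w.re = 0) (h : w.im < z.im) : arg (z - w) = π / 2 :=
    Complex.arg_eq_pi_div_two_iff.2 ⟨by simp [hz, hw], by simpa using h⟩
  have down {z w : ℂ} (hz : z.re = 0) (hw : w.re = 0) (h : z.im < w.im) :
      arg (z - w) = -(π / 2) :=
    Complex.arg_eq_neg_pi_div_two_iff.2 ⟨by simp [hz, hw], by simpa using h⟩
  have left := vert h0 hα0
  have right := vert h1 hα1
  have bottom := horiz h0 hβ0
  have top := horiz h1 hβ1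
  rw [up hβ0 hα0 h₁, up hβ1 hα0 (by linarith)] at left
  rw [up hβ1 hα1 h₃, down hβ0 hα1 h₂] at right
  rw [up hα1 hβ0 h₂, down hα0 hβ0 h₁] at bottom
  rw [down hα1 hβ1 h₃, down hα0 hβ1 (by linarith)] at top
  linarith [pi_pos]

/-! ### Primitives and secants -/

lemma exists_primitive_exp_eq {K : Set ℝ} (hK : Convex ℝ K) {a : ℝ} (ha : a ∈ K) {X G : ℝ → ℂ}
    (hG : Continuous G) (hX : ∀ t ∈ K, HasDerivWithinAt X (G t * X t) K t) {w : ℂ}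
    (hw : exp w = X a) :
    ∃ Γ : ℝ → ℂ, (∀ t, HasDerivAt Γ (G t) t) ∧ Γ a = w ∧ ∀ t ∈ K, exp (Γ t) = X t := by
  set Γ : ℝ → ℂ := fun t => w + ∫ v in a..t, G v
  have hΓ t : HasDerivAt Γ (G t) t := ((hG.integral_hasStrictDerivAt a t).hasDerivAt).const_add w
  have hΓa : Γ a = w := by simp [Γ]
  refine ⟨Γ, hΓ, hΓa, fun t ht => ?_⟩
  have hderiv : ∀ t ∈ K, HasDerivWithinAt (fun t => exp (-Γ t) * X t) 0 K t := fun t ht =>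
    (((hΓ t).neg.cexp.hasDerivWithinAt (s := K)).mul (hX t ht)).congr_deriv (by ring)
  have hconst := hK.norm_image_sub_le_of_norm_hasDerivWithin_le (C := 0) hderiv
    (fun _ _ => by simp) ha ht
  rw [zero_mul, norm_le_zero_iff, sub_eq_zero, hΓa, ← hw, ← Complex.exp_add, neg_add_cancel,
    Complex.exp_zero, Complex.exp_neg] at hconst
  exact eq_of_inv_mul_eq_one hconst

section Secant

/-- The slope of the secant between the parameters `p.1` and `p.2` of a primitive of `G`, with
the value `G t` at `(t, t)`. -/
noncomputable def secant (G : ℝ → ℂ) (p : ℝ × ℝ) : ℂ :=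
  ∫ v in (0 : ℝ)..1, G (p.1 + (p.2 - p.1) * v)

variable {Γ G : ℝ → ℂ} {a b : ℝ}

lemma continuous_secant (hG : Continuous G) : Continuous (secant G) := by
  unfold secant
  apply intervalIntegral.continuous_parametric_intervalIntegral_of_continuous'
  unfold Function.uncurry
  fun_prop

lemma secant_self (G : ℝ → ℂ) (t : ℝ) : secant G (t, t) = G t := by
  simp [secant]

lemma secant_add_add {c : ℝ} (h : Function.Periodic G c) (a b : ℝ) :
    secant G (a + c, b + c) = secant G (a, b) := by
  refine intervalIntegral.integral_congr fun v _ => ?_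
  rw [← h (a + _)]
  congr 1
  ring

lemma mul_secant (hG : Continuous G) (hΓ : ∀ t, HasDerivAt Γ (G t) t) (a b : ℝ) :
    ((b - a : ℝ) : ℂ) * secant G (a, b) = Γ b - Γ a := by
  have h := intervalIntegral.smul_integral_comp_add_mul (a := 0) (b := 1) G (b - a) a
  rw [secant, ← Complex.real_smul, h, intervalIntegral.integral_eq_sub_of_hasDerivAt
    (fun x _ => hΓ x) (hG.intervalIntegrable _ _)]
  congr 2 <;> ring

lemma secant_ne_zero (hG : Continuous G) (hΓ : ∀ t, HasDerivAt Γ (G t) t) {K : Set ℝ}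
    (hG0 : ∀ t ∈ K, G t ≠ 0) (hinj : InjOn Γ K) (ha : a ∈ K) (hb : b ∈ K) :
    secant G (a, b) ≠ 0 := by
  rcases eq_or_ne a b with rfl | hab
  · rw [secant_self]
    exact hG0 a ha
  · intro h
    have := mul_secant hG hΓ a b
    rw [h, mul_zero, eq_comm, sub_eq_zero] at this
    exact hab (hinj ha hb this.symm)

lemma re_mul_secant (hG : Continuous G) (hΓ : ∀ t, HasDerivAt Γ (G t) t) (a b : ℝ) :
    (b - a) * (secant G (a, b)).re = (Γ b).re - (Γ a).re := by
  rw [← Complex.re_ofReal_mul, mul_secant hG hΓ, Complex.sub_re]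

lemma re_secant_nonneg (hG : Continuous G) (hΓ : ∀ t, HasDerivAt Γ (G t) t) (hab : a ≤ b)
    (h0 : a = b → 0 ≤ (G a).re) (h : (Γ a).re ≤ (Γ b).re) : 0 ≤ (secant G (a, b)).re := by
  rcases hab.eq_or_lt with rfl | hab
  · simpa only [secant_self] using h0 rfl
  · refine nonneg_of_mul_nonneg_right ?_ (sub_pos.2 hab)
    rw [re_mul_secant hG hΓ]
    linarith

lemma re_secant_nonpos (hG : Continuous G) (hΓ : ∀ t, HasDerivAt Γ (G t) t) (hab : a ≤ b)
    (h0 : a = b → (G a).re ≤ 0) (h : (Γ b).re ≤ (Γ a).re) : (secant G (a, b)).re ≤ 0 := by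
  rcases hab.eq_or_lt with rfl | hab
  · simpa only [secant_self] using h0 rfl
  · refine nonpos_of_mul_nonpos_right ?_ (sub_pos.2 hab)
    rw [re_mul_secant hG hΓ]
    linarith

end Secant

/-! ### The turning of embedded curves

Hopf's trick: the direction of the secants is defined on the whole square of parameters, so that
the turning of the tangent, along the diagonal, can be computed along the edges. -/

section Turning

variable {Γ G : ℝ → ℂ}

lemma exists_log_deriv_of_translation (hG : Continuous G) (hΓ : ∀ t, HasDerivAt Γ (G t) t)
    (hG0 : ∀ t, G t ≠ 0) (hinj : Function.Injective Γ) {c : ℂ}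
    (hper : ∀ t, Γ (t + 1) = Γ t + c) :
    ∃ ℓ : ℝ → ℂ, Continuous ℓ ∧ (∀ t, exp (ℓ t) = G t) ∧ ℓ 0 = ℓ 1 := by
  obtain ⟨L, hL, hexp⟩ := exists_log_of_convex (f := secant G) convex_univ univ_nonempty
    (continuous_secant hG).continuousOn
    fun p _ => secant_ne_zero hG hΓ (fun t _ => hG0 t) hinj.injOn (mem_univ p.1) (mem_univ p.2)
  replace hL : Continuous L := continuousOn_univ.1 hL
  replace hexp p : exp (L p) = secant G p := hexp p trivial
  have hGper : Function.Periodic G 1 := fun t =>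
    (((hΓ (t + 1)).comp_add_const t 1).congr_of_eventuallyEq
      (.of_forall fun s => (hper s).symm)).unique ((hΓ t).add_const c)
  have hsecant a : secant G (a, a + 1) = c := by
    simpa [hper] using mul_secant hG hΓ a (a + 1)
  have hshift : L (1, 1) - L (0, 0) = L (1, 1 + 1) - L (0, 1) := by
    simpa using sub_eq_sub_of_exp_eq_exp isPreconnected_univ
      (L := fun p : ℝ × ℝ => L (p.1 + 1, p.2 + 1)) (L' := L) (by fun_prop) (by fun_prop)
      (fun p _ => by simp only [hexp, secant_add_add hGper]) (mem_univ (0, 0)) (mem_univ (0, 1))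
  have hdiag : L (1, 1 + 1) = L (0, 1) := by
    simpa [sub_eq_zero] using sub_eq_sub_of_exp_eq_exp isPreconnected_univ
      (L := fun a : ℝ => L (a, a + 1)) (L' := fun _ => L (0, 0 + 1)) (by fun_prop) (by fun_prop)
      (fun a _ => by simp only [hexp, hsecant]) (mem_univ 1) (mem_univ 0)
  refine ⟨fun t => L (t, t), by fun_prop, fun t => by rw [hexp, secant_self], ?_⟩
  rw [hdiag, sub_self, sub_eq_zero] at hshift
  exact hshift.symm

lemma exists_log_secant (hG : Continuous G) (hΓ : ∀ t, HasDerivAt Γ (G t) t)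
    (hG0 : ∀ t ∈ Icc (0 : ℝ) 1, G t ≠ 0) (hinj : InjOn Γ (Icc 0 1)) :
    ∃ L : ℝ × ℝ → ℂ, ContinuousOn L (Icc 0 1 ×ˢ Icc 0 1) ∧
      ∀ p ∈ Icc (0 : ℝ) 1 ×ˢ Icc (0 : ℝ) 1, exp (L p) = secant G p :=
  exists_log_of_convex ((convex_Icc 0 1).prod (convex_Icc 0 1))
    ((nonempty_Icc.2 zero_le_one).prod (nonempty_Icc.2 zero_le_one))
    (continuous_secant hG).continuousOn fun _ hp => secant_ne_zero hG hΓ hG0 hinj hp.1 hp.2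

lemma exists_log_deriv_of_crossing (hG : Continuous G) (hΓ : ∀ t, HasDerivAt Γ (G t) t)
    (hG0 : ∀ t ∈ Icc (0 : ℝ) 1, G t ≠ 0) (hinj : InjOn Γ (Icc 0 1))
    (hmin : ∀ t ∈ Icc (0 : ℝ) 1, (Γ 0).re ≤ (Γ t).re)
    (hmax : ∀ t ∈ Icc (0 : ℝ) 1, (Γ t).re ≤ (Γ 1).re) (h0 : 0 ≤ (G 0).re) (h1 : 0 ≤ (G 1).re) :
    ∃ ℓ : ℝ → ℂ, ContinuousOn ℓ (Icc 0 1) ∧ (∀ t ∈ Icc (0 : ℝ) 1, exp (ℓ t) = G t) ∧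
      (ℓ 1).im - (ℓ 0).im = arg (G 1) - arg (G 0) := by
  have zero_mem : (0 : ℝ) ∈ Icc (0 : ℝ) 1 := unitInterval.zero_mem
  have one_mem : (1 : ℝ) ∈ Icc (0 : ℝ) 1 := unitInterval.one_mem
  obtain ⟨L, hL, hexp⟩ := exists_log_secant hG hΓ hG0 hinj
  have left := im_sub_im_of_re_nonneg isPreconnected_Icc (L := fun t => L (0, t))
    (hL.comp (by fun_prop) fun t ht => ⟨zero_mem, ht⟩) (fun t ht => hexp _ ⟨zero_mem, ht⟩)
    (fun t ht => re_secant_nonneg hG hΓ ht.1 (fun _ => h0) (hmin t ht)) one_mem zero_mem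
  have top := im_sub_im_of_re_nonneg isPreconnected_Icc (L := fun t => L (t, 1))
    (hL.comp (by fun_prop) fun t ht => ⟨ht, one_mem⟩) (fun t ht => hexp _ ⟨ht, one_mem⟩)
    (fun t ht => re_secant_nonneg hG hΓ ht.2 (fun h => h ▸ h1) (hmax t ht)) one_mem zero_mem
  refine ⟨fun t => L (t, t), hL.comp (by fun_prop) fun t ht => ⟨ht, ht⟩,
    fun t ht => by rw [hexp _ ⟨ht, ht⟩, secant_self], ?_⟩
  simp only [secant_self] at left top
  linarith

lemma exists_log_deriv_of_returning (hG : Continuous G) (hΓ : ∀ t, HasDerivAt Γ (G t) t)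
    (hG0 : ∀ t ∈ Icc (0 : ℝ) 1, G t ≠ 0) (hinj : InjOn Γ (Icc 0 1))
    (hmin : ∀ t ∈ Icc (0 : ℝ) 1, (Γ 0).re ≤ (Γ t).re) (hend : (Γ 1).re = (Γ 0).re)
    (h0 : 0 ≤ (G 0).re) (h1 : (G 1).re ≤ 0) :
    ∃ ℓ : ℝ → ℂ, ContinuousOn ℓ (Icc 0 1) ∧ (∀ t ∈ Icc (0 : ℝ) 1, exp (ℓ t) = G t) ∧
      ((Γ 0).im < (Γ 1).im → (ℓ 1).im - (ℓ 0).im = arg (-G 1) - arg (G 0) + π) ∧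
      ((Γ 1).im < (Γ 0).im → (ℓ 1).im - (ℓ 0).im = arg (-G 1) - arg (G 0) - π) := by
  have zero_mem : (0 : ℝ) ∈ Icc (0 : ℝ) 1 := unitInterval.zero_mem
  have one_mem : (1 : ℝ) ∈ Icc (0 : ℝ) 1 := unitInterval.one_mem
  obtain ⟨L, hL, hexp⟩ := exists_log_secant hG hΓ hG0 hinj
  have left := im_sub_im_of_re_nonneg isPreconnected_Icc (L := fun t => L (0, t))
    (hL.comp (by fun_prop) fun t ht => ⟨zero_mem, ht⟩) (fun t ht => hexp _ ⟨zero_mem, ht⟩)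
    (fun t ht => re_secant_nonneg hG hΓ ht.1 (fun _ => h0) (hmin t ht)) one_mem zero_mem
  have top := im_sub_im_of_re_nonpos isPreconnected_Icc (L := fun t => L (t, 1))
    (hL.comp (by fun_prop) fun t ht => ⟨ht, one_mem⟩) (fun t ht => hexp _ ⟨ht, one_mem⟩)
    (fun t ht => re_secant_nonpos hG hΓ ht.2 (fun h => h ▸ h1) (hend ▸ hmin t ht))
    one_mem zero_mem
  have hchord : secant G (0, 1) = Γ 1 - Γ 0 := by simpa using mul_secant hG hΓ 0 1
  have hre : (Γ 1 - Γ 0).re = 0 := by simp [hend]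
  simp only [secant_self, hchord] at left top
  refine ⟨fun t => L (t, t), hL.comp (by fun_prop) fun t ht => ⟨ht, ht⟩,
    fun t ht => by rw [hexp _ ⟨ht, ht⟩, secant_self], fun h => ?_, fun h => ?_⟩
  · rw [Complex.arg_eq_pi_div_two_iff.2 ⟨hre, by simpa using h⟩] at left
    rw [Complex.arg_eq_neg_pi_div_two_iff.2
      (show (-(Γ 1 - Γ 0)).re = 0 ∧ _ from ⟨by simp [hend], by simpa using h⟩)] at top
    linarith
  · rw [Complex.arg_eq_neg_pi_div_two_iff.2 ⟨hre, by simpa using h⟩] at left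
    rw [Complex.arg_eq_pi_div_two_iff.2
      (show (-(Γ 1 - Γ 0)).re = 0 ∧ _ from ⟨by simp [hend], by simpa using h⟩)] at top
    linarith

end Turning

/-! ### Lines and angles between lines -/

lemma toIcoMod_arg_neg (z : ℂ) : toIcoMod pi_pos 0 (arg (-z)) = toIcoMod pi_pos 0 (arg z) := by
  rcases eq_or_ne z 0 with rfl | hz
  · rw [neg_zero]
  obtain ⟨n, hn⟩ := Real.Angle.angle_eq_iff_two_pi_dvd_sub.1
    ((Complex.arg_neg_coe_angle hz).trans (Real.Angle.coe_add _ _).symm)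
  rw [show arg (-z) = arg z + (2 * n + 1 : ℤ) • π by push_cast [zsmul_eq_mul]; linarith,
    toIcoMod_add_zsmul]

lemma ccwAngle_real_mul_right {c : ℝ} (hc : c ≠ 0) (v w : ℂ) :
    ccwAngle v (c * w) = ccwAngle v w := by
  rw [ccwAngle, ccwAngle, mul_div_assoc]
  rcases hc.lt_or_gt with hc | hc
  · rw [← toIcoMod_arg_neg, ← neg_mul, ← Complex.ofReal_neg, Complex.arg_real_mul _ (neg_pos.2 hc)]
  · rw [Complex.arg_real_mul _ hc]

lemma ccwAngle_real_mul_left {c : ℝ} (hc : c ≠ 0) (v w : ℂ) :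
    ccwAngle (c * v) w = ccwAngle v w := by
  rw [← ccwAngle_real_mul_right (inv_ne_zero hc) v, ccwAngle, ccwAngle, Complex.ofReal_inv,
    ← div_eq_inv_mul, div_div]

lemma ccwAngle_mul_mul {z : ℂ} (hz : z ≠ 0) (v w : ℂ) :
    ccwAngle (v * z) (w * z) = ccwAngle v w := by
  rw [ccwAngle, ccwAngle, mul_div_mul_right _ _ hz]

lemma ccwAngle_I {v : ℂ} (hv : 0 < v.re) : ccwAngle v I = π / 2 - arg v := by
  have hv0 : v ≠ 0 := by
    rintro rfl
    exact hv.false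
  obtain ⟨h₁, h₂⟩ := abs_lt.1 (Complex.abs_arg_lt_pi_div_two_iff.2 (Or.inl hv))
  have hinv : arg v⁻¹ = -arg v := by rw [Complex.arg_inv, if_neg (by linarith)]
  have harg : arg (I / v) = π / 2 - arg v := by
    rw [div_eq_mul_inv, Complex.arg_mul Complex.I_ne_zero (inv_ne_zero hv0), Complex.arg_I, hinv,
      sub_eq_add_neg]
    rw [Complex.arg_I, hinv]
    exact ⟨by linarith, by linarith⟩
  rw [ccwAngle, harg, toIcoMod_eq_self]
  exact ⟨by linarith, by linarith⟩

lemma continuous_lineToCircle : Continuous lineToCircle := by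
  refine continuous_coinduced_dom.2 (Continuous.inv (continuous_induced_rng.2 ?_))
  exact (Complex.continuous_conj.comp continuous_subtype_val).div continuous_subtype_val
    Subtype.prop

lemma coe_lineToCircle_mk {v : ℂ} (hv : v ≠ 0) :
    (lineToCircle (Projectivization.mk ℝ v hv) : ℂ) = v / (starRingEnd ℂ) v :=
  (Circle.coe_inv _).trans (inv_div _ _)

lemma lineToCircle_injective : Function.Injective lineToCircle := by
  intro a b h
  induction a using Projectivization.ind with | h v hv
  induction b using Projectivization.ind with | h w hw
  have hdiv := congrArg ((↑) : Circle → ℂ) h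
  rw [coe_lineToCircle_mk, coe_lineToCircle_mk, div_eq_div_iff (by simpa) (by simpa)] at hdiv
  obtain ⟨c, hc⟩ := Complex.conj_eq_iff_real.1 <|
    show (starRingEnd ℂ) (v / w) = v / w by
      rw [map_div₀, div_eq_div_iff (by simpa) hw, mul_comm, ← hdiv]
  rw [Projectivization.mk_eq_mk_iff']
  exact ⟨c, by rw [Complex.real_smul, ← hc, div_mul_cancel₀ v hw]⟩

lemma lineToCircle_mk_exp (w : ℂ) :
    lineToCircle (Projectivization.mk ℝ (exp w) (Complex.exp_ne_zero w)) =
      Circle.exp (2 * w.im) := by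
  ext
  rw [coe_lineToCircle_mk, ← Complex.exp_conj, ← Complex.exp_sub, Complex.sub_conj, Circle.coe_exp]

lemma mk_exp_eq_mk_exp_iff {a b : ℂ} :
    Projectivization.mk ℝ (exp a) (Complex.exp_ne_zero a) =
      Projectivization.mk ℝ (exp b) (Complex.exp_ne_zero b) ↔ ∃ n : ℤ, a.im = b.im + n * π := by
  rw [← lineToCircle_injective.eq_iff, lineToCircle_mk_exp, lineToCircle_mk_exp, Circle.exp_eq_exp]
  exact exists_congr fun n => ⟨fun h => by linarith, fun h => by linarith⟩

lemma continuous_projectivization_mk {A : Type*} [TopologicalSpace A] {f : A → ℂ}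
    (hf : Continuous f) (h0 : ∀ a, f a ≠ 0) :
    Continuous fun a => Projectivization.mk ℝ (f a) (h0 a) :=
  continuous_coinduced_rng.comp (hf.subtype_mk h0)

/-- The line at `z` that makes the angle `θ` with the circle direction. -/
noncomputable def rotatedLine (z : ℂ) (hz : z ≠ 0) (θ : ℝ) : ℙ ℝ ℂ :=
  Projectivization.mk ℝ (I * z * exp (θ * I))
    (mul_ne_zero (mul_ne_zero Complex.I_ne_zero hz) (Complex.exp_ne_zero _))

lemma rotatedLine_exp (w : ℂ) (θ : ℝ) : rotatedLine (exp w) (Complex.exp_ne_zero w) θ =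
    Projectivization.mk ℝ (exp (w + (π / 2 + θ) * I)) (Complex.exp_ne_zero _) := by
  unfold rotatedLine
  congr 1
  rw [Complex.exp_add, add_mul, Complex.exp_add, Complex.exp_pi_div_two_mul_I]
  ring

lemma mem_rotatedLine_iff {z : ℂ} {hz : z ≠ 0} {θ : ℝ} {v : ℂ} :
    v ∈ (rotatedLine z hz θ).submodule ↔ ∃ c : ℝ, v = c * (I * z * exp (θ * I)) := by
  rw [rotatedLine, Projectivization.submodule_mk, Submodule.mem_span_singleton]
  simp only [Complex.real_smul, eq_comm]

/-! ### Angles of foliations -/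

lemma exp_mem_annulus_iff {w : ℂ} : exp w ∈ annulus ↔ 0 ≤ w.re ∧ w.re ≤ Real.log 2 := by
  change 1 ≤ ‖exp w‖ ∧ ‖exp w‖ ≤ 2 ↔ _
  rw [Complex.norm_exp, Real.one_le_exp_iff, Real.le_log_iff_exp_le (by norm_num)]

lemma exp_ofReal_mul_I_mem_annulus (t : ℝ) : exp (t * I) ∈ annulus := by
  rw [exp_mem_annulus_iff]
  simp [Real.log_nonneg]

/-- The retraction of the plane to the strip `{w | exp w ∈ annulus}`. It extends functions of
logarithmic coordinates to the whole plane. -/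
noncomputable def stripRetraction (w : ℂ) : ℂ :=
  (projIcc 0 (Real.log 2) (Real.log_nonneg one_le_two) w.re : ℝ) + w.im * I

lemma continuous_stripRetraction : Continuous stripRetraction := by
  unfold stripRetraction
  exact ((Complex.continuous_ofReal.comp continuous_subtype_val).comp
    (continuous_projIcc.comp Complex.continuous_re)).add (by fun_prop)

lemma exp_stripRetraction_mem_annulus (w : ℂ) : exp (stripRetraction w) ∈ annulus := by
  rw [exp_mem_annulus_iff]
  simp only [stripRetraction, Complex.add_re, Complex.ofReal_re, Complex.re_ofReal_mul,
    Complex.I_re, mul_zero, add_zero]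
  exact (projIcc 0 (Real.log 2) _ w.re).2

lemma stripRetraction_of_mem {w : ℂ} (hw : exp w ∈ annulus) : stripRetraction w = w := by
  rw [stripRetraction, projIcc_of_mem _ (exp_mem_annulus_iff.1 hw), Complex.re_add_im]

lemma exp_stripRetraction_periodic :
    Function.Periodic (fun w => exp (stripRetraction w)) (2 * π * I) := fun w => by
  have : stripRetraction (w + 2 * π * I) = stripRetraction w + 2 * π * I := by
    have hre : (w + 2 * π * I).re = w.re := by simp
    have him : (w + 2 * π * I).im = w.im + 2 * π := by simp
    rw [stripRetraction, hre, him, stripRetraction]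
    push_cast
    ring
  simp only [this, Complex.exp_periodic _]

lemma exists_angle_family {E : Type*} [NormedAddCommGroup E] [NormedSpace ℝ E]
    {K : E × annulus → ℙ ℝ ℂ} (hK : Continuous K) :
    ∃ (ψ : E × ℂ → ℝ) (d : ℤ), Continuous ψ ∧
      (∀ s w (hw : exp w ∈ annulus),
        K (s, ⟨exp w, hw⟩) = rotatedLine (exp w) (Complex.exp_ne_zero w) (ψ (s, w))) ∧
      ∀ s w, ψ (s, w + 2 * π * I) = ψ (s, w) + d * π := by
  let e (w : ℂ) : annulus := ⟨exp (stripRetraction w), exp_stripRetraction_mem_annulus w⟩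
  have he : Continuous e := continuous_stripRetraction.cexp.subtype_mk _
  obtain ⟨φ, hφ, hexp⟩ := exists_angle_of_convex convex_univ univ_nonempty
    (f := fun p : E × ℂ => lineToCircle (K (p.1, e p.2)))
    (continuous_lineToCircle.comp (hK.comp (by fun_prop))).continuousOn
  replace hφ : Continuous φ := continuousOn_univ.1 hφ
  have hstep (p : E × ℂ) (_ : p ∈ univ) :
      φ (p.1, p.2 + 2 * π * I) - φ p ∈ AddSubgroup.zmultiples (2 * π) := by
    have heq : e (p.2 + 2 * π * I) = e p.2 := Subtype.ext (exp_stripRetraction_periodic p.2)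
    obtain ⟨n, hn⟩ := Circle.exp_eq_exp.1 <|
      show Circle.exp (φ (p.1, p.2 + 2 * π * I)) = Circle.exp (φ p) by
        rw [hexp _ trivial, hexp _ trivial, heq]
    exact ⟨n, by simp only [zsmul_eq_mul]; linarith⟩
  obtain ⟨n, hn⟩ := hstep (0, 0) trivial
  refine ⟨fun p => φ p / 2 - p.2.im - π / 2, n - 2, by fun_prop, fun s w hw => ?_, fun s w => ?_⟩
  · have heq : e w = ⟨exp w, hw⟩ := Subtype.ext (congrArg exp (stripRetraction_of_mem hw))
    apply lineToCircle_injective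
    rw [rotatedLine_exp, lineToCircle_mk_exp, ← heq, ← hexp (s, w) trivial]
    congr 1
    rw [Complex.add_im, Complex.mul_I_im, Complex.add_re, Complex.div_ofNat_re, Complex.ofReal_re,
      Complex.ofReal_re]
    ring
  · have hconst := eq_of_forall_mem_zmultiples isPreconnected_univ
      (f := fun p : E × ℂ => φ (p.1, p.2 + 2 * π * I) - φ p) (by fun_prop) hstep
      (mem_univ (s, w)) (mem_univ (0, 0))
    rw [← hn] at hconst
    simp only [zsmul_eq_mul] at hconst
    have him : (w + 2 * π * I).im = w.im + 2 * π := by simp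
    simp only [him]
    push_cast
    linarith

/-- `ψ` is an angle of the foliation `η` relative to the circle direction, as a function of
`log z`, with increment `d π` over one turn. Its values matter on the strip over the annulus
only. -/
structure IsAngle (η : Foliation) (ψ : ℂ → ℝ) (d : ℤ) : Prop where
  continuous : Continuous ψ
  spec : ∀ w (hw : exp w ∈ annulus),
    η ⟨exp w, hw⟩ = rotatedLine (exp w) (Complex.exp_ne_zero w) (ψ w)
  add_two_pi_mul_I : ∀ w, ψ (w + 2 * π * I) = ψ w + d * π

/-- `Ψ` is an angle of the foliation `η` relative to the circle direction, as a function on the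
annulus. -/
structure IsGlobalAngle (η : Foliation) (Ψ : ℂ → ℝ) : Prop where
  continuousOn : ContinuousOn Ψ annulus
  spec : ∀ z (hz : z ∈ annulus), η ⟨z, hz⟩ = rotatedLine z (ne_zero_of_mem_annulus hz) (Ψ z)

lemma exists_isAngle (η : Foliation) : ∃ ψ d, IsAngle η ψ d := by
  obtain ⟨ψ, d, hψ, hs, hp⟩ := exists_angle_family (E := ℝ) (K := fun p => η p.2) (by fun_prop)
  exact ⟨fun w => ψ (0, w), d, by fun_prop, hs 0, hp 0⟩

lemma IsAngle.unique {η : Foliation} {ψ ψ' : ℂ → ℝ} {d d' : ℤ} (h : IsAngle η ψ d)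
    (h' : IsAngle η ψ' d') : d = d' := by
  have hc := h.continuous
  have hc' := h'.continuous
  have hdiff (t : ℝ) (_ : t ∈ univ) : ψ (t * I) - ψ' (t * I) ∈ AddSubgroup.zmultiples π := by
    have heq := (h.spec _ (exp_ofReal_mul_I_mem_annulus t)).symm.trans (h'.spec _ _)
    rw [rotatedLine_exp, rotatedLine_exp, mk_exp_eq_mk_exp_iff] at heq
    obtain ⟨n, hn⟩ := heq
    refine ⟨n, ?_⟩
    simp only [Complex.add_im, Complex.mul_I_im, Complex.add_re, Complex.ofReal_re] at hn
    simp only [zsmul_eq_mul]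
    linarith
  have hconst := eq_of_forall_mem_zmultiples isPreconnected_univ
    (f := fun t : ℝ => ψ (t * I) - ψ' (t * I)) (by fun_prop) hdiff
    (mem_univ (2 * π)) (mem_univ 0)
  have hψ := h.add_two_pi_mul_I 0
  have hψ' := h'.add_two_pi_mul_I 0
  simp only [Complex.ofReal_zero, zero_mul, zero_add] at hconst hψ hψ'
  push_cast at hconst
  rw [hψ, hψ'] at hconst
  exact_mod_cast mul_right_cancel₀ pi_pos.ne' (show (d : ℝ) * π = d' * π by linarith)

lemma IsAngle.eq_of_exp_eq {η : Foliation} {ψ : ℂ → ℝ} (h : IsAngle η ψ 0) {w w' : ℂ}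
    (hw : exp w = exp w') : ψ w = ψ w' := by
  have hper : Function.Periodic ψ (2 * π * I) := fun w => by simp [h.add_two_pi_mul_I]
  obtain ⟨n, rfl⟩ := Complex.exp_eq_exp_iff_exists_int.1 hw
  exact hper.int_mul n w'

lemma IsAngle.isGlobalAngle {η : Foliation} {ψ : ℂ → ℝ} (h : IsAngle η ψ 0) :
    IsGlobalAngle η (fun z => ψ (Complex.log z)) := by
  refine ⟨fun z hz => ContinuousAt.continuousWithinAt ?_, fun z hz => ?_⟩
  · have hz0 := ne_zero_of_mem_annulus hz
    -- `log (u / z) + log z` is a branch of `log u` that is continuous at `z`.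
    have heq : (fun u => ψ (Complex.log (u / z) + Complex.log z)) =ᶠ[𝓝 z]
        fun u => ψ (Complex.log u) := by
      filter_upwards [isOpen_ne.mem_nhds hz0] with u hu
      apply h.eq_of_exp_eq
      rw [Complex.exp_add, Complex.exp_log hu, Complex.exp_log hz0,
        Complex.exp_log (div_ne_zero hu hz0), div_mul_cancel₀ _ hz0]
    refine ContinuousAt.congr (h.continuous.continuousAt.comp ?_) heq
    exact ((continuousAt_id.div_const z).clog (by simp [hz0])).add continuousAt_const
  · have hexp := Complex.exp_log (ne_zero_of_mem_annulus hz)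
    simpa only [hexp] using h.spec (Complex.log z) (by rwa [hexp])

/-! ### The homotopy class and the degree -/

/-- The foliation by concentric circles, which represents the balanced class. -/
noncomputable def circleFoliation : Foliation where
  toFun z := rotatedLine z (ne_zero_of_mem_annulus z.2) 0
  continuous_toFun := continuous_projectivization_mk (by fun_prop) _

lemma isAngle_circleFoliation : IsAngle circleFoliation (fun _ => 0) 0 :=
  ⟨continuous_const, fun _ _ => rfl, by simp⟩

lemma IsAngle.eq_of_homotopic {η η' : Foliation} {ψ ψ' : ℂ → ℝ} {d d' : ℤ} (h : IsAngle η ψ d)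
    (h' : IsAngle η' ψ' d') (hη : ContinuousMap.Homotopic η η') : d = d' := by
  obtain ⟨H⟩ := hη
  obtain ⟨φ, e, hφ, hs, hp⟩ := exists_angle_family
    (K := fun p : ℝ × annulus => H (projIcc 0 1 zero_le_one p.1, p.2))
    (H.continuous.comp ((continuous_projIcc.comp continuous_fst).prodMk continuous_snd))
  have h0 : IsAngle η (fun w => φ (0, w)) e :=
    ⟨by fun_prop, fun w hw => by rw [← hs 0 w hw]; simp, hp 0⟩
  have h1 : IsAngle η' (fun w => φ (1, w)) e :=
    ⟨by fun_prop, fun w hw => by rw [← hs 1 w hw]; simp, hp 1⟩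
  rw [h.unique h0, h'.unique h1]

lemma IsGlobalAngle.homotopic_circleFoliation {η : Foliation} {Ψ : ℂ → ℝ}
    (h : IsGlobalAngle η Ψ) : ContinuousMap.Homotopic η circleFoliation := by
  have hΨ : Continuous fun z : annulus => Ψ z :=
    continuousOn_iff_continuous_domRestrict.1 h.continuousOn
  have hcont : Continuous fun p : unitInterval × annulus =>
      I * (p.2 : ℂ) * exp (((1 - (p.1 : ℝ)) * Ψ p.2 : ℝ) * I) := by
    have hangle : Continuous fun p : unitInterval × annulus => (1 - (p.1 : ℝ)) * Ψ p.2 :=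
      (by fun_prop : Continuous fun p : unitInterval × annulus => 1 - (p.1 : ℝ)).mul
        (hΨ.comp continuous_snd)
    have hofReal := Complex.continuous_ofReal.comp hangle
    exact (by fun_prop : Continuous fun p : unitInterval × annulus => I * (p.2 : ℂ)).mul
      (hofReal.mul continuous_const).cexp
  exact ⟨{
    toFun := fun p => rotatedLine p.2 (ne_zero_of_mem_annulus p.2.2) ((1 - (p.1 : ℝ)) * Ψ p.2)
    continuous_toFun := continuous_projectivization_mk hcont _
    map_zero_left := fun z => by simp [h.spec z.1 z.2]
    map_one_left := fun z => by
      simp only [Icc.coe_one, sub_self, zero_mul]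
      rfl }⟩

lemma IsAngle.toClass_eq_iff {η : Foliation} {ψ : ℂ → ℝ} {d : ℤ} (h : IsAngle η ψ d) :
    η.toClass = circleFoliation.toClass ↔ d = 0 := by
  refine Quotient.eq.trans ⟨h.eq_of_homotopic isAngle_circleFoliation, ?_⟩
  rintro rfl
  exact h.isGlobalAngle.homotopic_circleFoliation

lemma HasDegree.unique {f : Circle → Circle} {d d' : ℤ} (h : HasDegree f d)
    (h' : HasDegree f d') : d = d' := by
  obtain ⟨F, hF, hf, hp⟩ := h
  obtain ⟨F', hF', hf', hp'⟩ := h'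
  have hdiff (t : ℝ) (_ : t ∈ univ) : F t - F' t ∈ AddSubgroup.zmultiples (2 * π) := by
    obtain ⟨n, hn⟩ := Circle.exp_eq_exp.1 ((hf t).symm.trans (hf' t))
    exact ⟨n, by simp only [zsmul_eq_mul]; linarith⟩
  have hconst := eq_of_forall_mem_zmultiples isPreconnected_univ (f := fun t => F t - F' t)
    (by fun_prop) hdiff (mem_univ (0 + 2 * π)) (mem_univ 0)
  simp only [hp, hp'] at hconst
  exact_mod_cast mul_right_cancel₀ Real.two_pi_pos.ne'
    (show (d : ℝ) * (2 * π) = d' * (2 * π) by linarith)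

lemma IsAngle.hasDegree {η : Foliation} {ψ : ℂ → ℝ} {d : ℤ} (h : IsAngle η ψ d) :
    HasDegree η.circleMap d := by
  have hc := h.continuous
  refine ⟨fun t => 2 * ψ (t * I), by fun_prop, fun t => ?_, fun t => ?_⟩
  · have hinner : innerCircle (Circle.exp t) = ⟨_, exp_ofReal_mul_I_mem_annulus t⟩ :=
      Subtype.ext (Circle.coe_exp t)
    have hframe : frameCoord (exp (t * I)) (I * exp (t * I) * exp (ψ (t * I) * I)) =
        exp (ψ (t * I) * I) :=
      inv_mul_cancel_left₀ (mul_ne_zero Complex.I_ne_zero (Complex.exp_ne_zero _)) _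
    rw [Foliation.circleMap, hinner, h.spec]
    simp only [trivialization, rotatedLine, Projectivization.map_mk, hframe, lineToCircle_mk_exp]
    simp
  · have htranslate : ((t + 2 * π : ℝ) : ℂ) * I = t * I + 2 * π * I := by
      push_cast
      ring
    simp only [htranslate, h.add_two_pi_mul_I]
    ring

/-! ### Gradings -/

lemma IsGrading.sub_eq {η : Foliation} {Ψ : ℂ → ℝ} (hη : IsGlobalAngle η Ψ) {γ : ℝ → ℂ}
    {a : ℝ → ℝ} {ℓ : ℝ → ℂ} (ha : IsGrading η γ a) (hγ : ContinuousOn γ (Icc 0 1))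
    (hmem : ∀ t ∈ Icc (0 : ℝ) 1, γ t ∈ annulus) (hℓ : ContinuousOn ℓ (Icc 0 1))
    (hv : ∀ t ∈ Icc (0 : ℝ) 1, velocity γ t = exp (ℓ t) * γ t) {t t' : ℝ}
    (ht : t ∈ Icc (0 : ℝ) 1) (ht' : t' ∈ Icc (0 : ℝ) 1) :
    a t - a t' = Ψ (γ t) - Ψ (γ t') - ((ℓ t).im - (ℓ t').im) := by
  have hcont : ContinuousOn (fun t => a t + (ℓ t).im - (Ψ (γ t) + π / 2)) (Icc 0 1) :=
    (ha.1.add (Complex.continuous_im.comp_continuousOn hℓ)).sub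
      ((hη.continuousOn.comp hγ hmem).add continuousOn_const)
  have hline (t : ℝ) (ht : t ∈ Icc (0 : ℝ) 1) :
      a t + (ℓ t).im - (Ψ (γ t) + π / 2) ∈ AddSubgroup.zmultiples π := by
    have hgrad := ha.2 t ht (hmem t ht)
    rw [hη.spec, mem_rotatedLine_iff, hv t ht] at hgrad
    obtain ⟨c, hc⟩ := hgrad
    have hreal : exp (a t * I + ℓ t - (Ψ (γ t) * I + π / 2 * I)) = c := by
      rw [Complex.exp_sub, Complex.exp_add, Complex.exp_add, Complex.exp_pi_div_two_mul_I,
        div_eq_iff (mul_ne_zero (Complex.exp_ne_zero _) Complex.I_ne_zero)]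
      exact mul_right_cancel₀ (ne_zero_of_mem_annulus (hmem t ht)) (by linear_combination hc)
    have him := congrArg Complex.im hreal
    rw [Complex.exp_im, Complex.ofReal_im, mul_eq_zero, or_iff_right (Real.exp_ne_zero _),
      Real.sin_eq_zero_iff] at him
    obtain ⟨n, hn⟩ := him
    exact ⟨n, by simpa using hn⟩
  have := eq_of_forall_mem_zmultiples isPreconnected_Icc hcont hline ht ht'
  linarith

/-! ### Curves that are straight in logarithmic coordinates -/

/-- The logarithmic spiral with the logarithm `A + B u`. Circles, radial segments and crossing
arcs of the annulus are parametrized in this way. -/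
noncomputable def spiral (A B : ℂ) (u : ℝ) : ℂ := exp (A + B * u)

lemma contDiff_spiral (A B : ℂ) : ContDiff ℝ ∞ (spiral A B) :=
  Complex.contDiff_exp.comp (contDiff_const.add (contDiff_const.mul Complex.ofRealCLM.contDiff))

lemma hasDerivAt_spiral (A B : ℂ) (u : ℝ) : HasDerivAt (spiral A B) (B * spiral A B u) u := by
  have hlin : HasDerivAt (fun u : ℝ => A + B * (u : ℂ)) B u := by
    simpa using ((Complex.ofRealCLM.hasDerivAt (x := u)).const_mul B).const_add A
  have hexp := hlin.cexp
  rwa [mul_comm] at hexp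

lemma velocity_spiral (A B : ℂ) {u : ℝ} (hu : u ∈ Icc (0 : ℝ) 1) :
    velocity (spiral A B) u = B * spiral A B u :=
  (hasDerivAt_spiral A B u).hasDerivWithinAt.derivWithin (uniqueDiffOn_Icc zero_lt_one u hu)

lemma spiral_ne_zero (A B : ℂ) (u : ℝ) : spiral A B u ≠ 0 := Complex.exp_ne_zero _

lemma isImmersedCurve_spiral {A B : ℂ} (hB : B ≠ 0)
    (hmem : ∀ u ∈ Icc (0 : ℝ) 1, spiral A B u ∈ annulus) : IsImmersedCurve (spiral A B) where
  smooth := (contDiff_spiral A B).contDiffOn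
  mem := hmem
  immersed u hu := by
    rw [velocity_spiral A B hu]
    exact mul_ne_zero hB (spiral_ne_zero A B u)

lemma IsAngle.isGrading_spiral {η : Foliation} {ψ : ℂ → ℝ} {d : ℤ} (h : IsAngle η ψ d)
    (A B : ℂ) : IsGrading η (spiral A B) (fun u => ψ (A + B * u) + (π / 2 - arg B)) := by
  have hc := h.continuous
  refine ⟨by fun_prop, fun u hu hmem => ?_⟩
  rw [show η ⟨spiral A B u, hmem⟩ = _ from h.spec (A + B * u) hmem, mem_rotatedLine_iff,
    velocity_spiral A B hu]
  refine ⟨‖B‖, ?_⟩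
  have hsplit : ((ψ (A + B * u) + (π / 2 - arg B) : ℝ) : ℂ) * I =
      ψ (A + B * u) * I + π / 2 * I - arg B * I := by
    push_cast
    ring
  have hpolar := (eq_div_iff (Complex.exp_ne_zero _)).2 (Complex.norm_mul_exp_arg_mul_I B)
  rw [hsplit, Complex.exp_sub, Complex.exp_add, Complex.exp_pi_div_two_mul_I, hpolar, spiral]
  ring

/-! ### Closed curves -/

lemma isNullhomotopic_iff_of_lift {γ Γ : ℝ → ℂ} (hmem : ∀ t ∈ Icc (0 : ℝ) 1, γ t ∈ annulus)
    (hΓ : ContinuousOn Γ (Icc 0 1)) (hexp : ∀ t ∈ Icc (0 : ℝ) 1, exp (Γ t) = γ t) :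
    IsNullhomotopic γ ↔ Γ 1 = Γ 0 := by
  have zero_mem : (0 : ℝ) ∈ Icc (0 : ℝ) 1 := unitInterval.zero_mem
  have one_mem : (1 : ℝ) ∈ Icc (0 : ℝ) 1 := unitInterval.one_mem
  constructor
  · rintro ⟨H, hH, hHmem, hstart, hclosed, hend⟩
    obtain ⟨L, hL, hLexp⟩ := exists_log_of_convex
      ((convex_Icc (0 : ℝ) 1).prod (convex_Icc (0 : ℝ) 1)) ⟨(0, 0), zero_mem, zero_mem⟩ hH
      fun p hp => ne_zero_of_mem_annulus (hHmem p.1 hp.1 p.2 hp.2)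
    have vert {s : ℝ} (hs : s ∈ Icc (0 : ℝ) 1) : ContinuousOn (fun t => L (s, t)) (Icc 0 1) :=
      hL.comp (by fun_prop) fun t ht => ⟨hs, ht⟩
    have horiz {t : ℝ} (ht : t ∈ Icc (0 : ℝ) 1) : ContinuousOn (fun s => L (s, t)) (Icc 0 1) :=
      hL.comp (by fun_prop) fun s hs => ⟨hs, ht⟩
    have hfirst := sub_eq_sub_of_exp_eq_exp isPreconnected_Icc (vert zero_mem) hΓ
      (fun t ht => by rw [hLexp _ ⟨zero_mem, ht⟩, hstart t ht, hexp t ht]) one_mem zero_mem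
    have hlast := sub_eq_sub_of_exp_eq_exp isPreconnected_Icc (vert one_mem)
      (continuousOn_const (c := L (1, 0)))
      (fun t ht => by rw [hLexp _ ⟨one_mem, ht⟩, hLexp _ ⟨one_mem, zero_mem⟩, hend t ht])
      one_mem zero_mem
    have hends := sub_eq_sub_of_exp_eq_exp isPreconnected_Icc (horiz zero_mem) (horiz one_mem)
      (fun s hs => by rw [hLexp _ ⟨hs, zero_mem⟩, hLexp _ ⟨hs, one_mem⟩, hclosed s hs])
      one_mem zero_mem
    linear_combination hlast - hfirst + hends
  · intro hloop
    have hseg (s : ℝ) (hs : s ∈ Icc (0 : ℝ) 1) (t : ℝ) (ht : t ∈ Icc (0 : ℝ) 1) :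
        exp (AffineMap.lineMap (Γ t) (Γ 0) s) ∈ annulus := by
      have hstrip : Convex ℝ {w | exp w ∈ annulus} := by
        simp only [exp_mem_annulus_iff, ofPred_and]
        exact (convex_halfSpace_re_ge 0).inter (convex_halfSpace_re_le _)
      exact hstrip.lineMap_mem (by simpa [hexp t ht] using hmem t ht)
        (by simpa [hexp 0 zero_mem] using hmem 0 zero_mem) hs
    refine ⟨fun p => exp (AffineMap.lineMap (Γ p.2) (Γ 0) p.1), ?_, hseg, fun t ht => ?_,
      fun s _ => ?_, fun t _ => ?_⟩
    · have hΓ₂ : ContinuousOn (fun p : ℝ × ℝ => Γ p.2) (Icc 0 1 ×ˢ Icc 0 1) :=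
        hΓ.comp continuousOn_snd fun p hp => hp.2
      exact (hΓ₂.lineMap continuousOn_const continuousOn_fst).cexp
    · simp only [AffineMap.lineMap_apply_zero, hexp t ht]
    · simp only [hloop]
    · simp only [AffineMap.lineMap_apply_one]

lemma isUnobstructedClosedCurve_spiral : IsUnobstructedClosedCurve (spiral 0 (2 * π * I)) where
  smooth := contDiff_spiral _ _
  periodic u := by
    rw [spiral, Complex.ofReal_add, mul_add, ← add_assoc, Complex.ofReal_one, mul_one,
      Complex.exp_periodic, spiral]
  mem u := by simp [spiral, exp_mem_annulus_iff, Real.log_nonneg]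
  immersed u := by
    rw [(hasDerivAt_spiral _ _ u).deriv]
    exact mul_ne_zero Complex.two_pi_I_ne_zero (spiral_ne_zero _ _ _)
  injOn := by
    intro a ha b hb hab
    obtain ⟨n, hn⟩ := Complex.exp_eq_exp_iff_exists_int.1 hab
    have hsub : a = b + n := by
      exact_mod_cast mul_left_cancel₀ Complex.two_pi_I_ne_zero
        (show (2 * π * I) * (a : ℂ) = 2 * π * I * (b + n) by linear_combination hn)
    have hlt : (n : ℝ) < 1 := by linarith [ha.2, hb.1]
    have hgt : (-1 : ℝ) < n := by linarith [ha.1, hb.2]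
    obtain rfl : n = 0 := by
      have : n < 1 := by exact_mod_cast hlt
      have : -1 < n := by exact_mod_cast hgt
      omega
    simpa using hsub
  not_nullhomotopic :=
    (isNullhomotopic_iff_of_lift (Γ := fun u => 0 + 2 * π * I * u)
      (fun u _ => by simp [exp_mem_annulus_iff, Real.log_nonneg]) (by fun_prop)
      fun u _ => rfl).not.2 (by simp [Real.pi_ne_zero])

lemma IsAngle.eq_zero_of_windsTrivially {η : Foliation} {ψ : ℂ → ℝ} {d : ℤ} (h : IsAngle η ψ d)
    (hw : WindsTrivially η) : d = 0 := by
  have hwind := hw _ isUnobstructedClosedCurve_spiral _ (h.isGrading_spiral 0 _)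
  have hturn := h.add_two_pi_mul_I 0
  rw [div_eq_zero_iff, or_iff_left Real.pi_ne_zero] at hwind
  simp only [Complex.ofReal_zero, Complex.ofReal_one, mul_zero, mul_one, add_zero, zero_add]
    at hwind hturn
  have hmul : (d : ℝ) * π = 0 := by linarith
  exact_mod_cast (mul_eq_zero.1 hmul).resolve_right Real.pi_ne_zero

lemma injective_of_exp_eq_periodic {γ Γ : ℝ → ℂ} {c : ℂ} (hγ : Function.Periodic γ 1)
    (hinj : InjOn γ (Ico 0 1)) (hexp : ∀ t, exp (Γ t) = γ t) (hΓ : ∀ t, Γ (t + 1) = Γ t + c)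
    (hc : c ≠ 0) : Function.Injective Γ := by
  intro a b hab
  have hfract (t : ℝ) : γ (Int.fract t) = γ t := by
    simpa using hγ.sub_int_mul_eq (x := t) ⌊t⌋
  obtain ⟨n, hn⟩ := Int.fract_eq_fract.1 <|
    hinj ⟨Int.fract_nonneg a, Int.fract_lt_one a⟩ ⟨Int.fract_nonneg b, Int.fract_lt_one b⟩ <| by
      rw [hfract, hfract, ← hexp a, ← hexp b, hab]
  have hshift : Γ (b + n) = Γ b + n • c :=
    AddConstMapClass.map_add_int' (⟨Γ, hΓ⟩ : AddConstMap ℝ ℂ 1 c) b n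
  rw [← hn, add_sub_cancel, hab, left_eq_add, smul_eq_zero, or_iff_left hc] at hshift
  rwa [hshift, Int.cast_zero, sub_eq_zero] at hn

lemma IsUnobstructedClosedCurve.exists_log_deriv {γ : ℝ → ℂ} (h : IsUnobstructedClosedCurve γ) :
    ∃ ℓ : ℝ → ℂ, Continuous ℓ ∧ (∀ t, deriv γ t = exp (ℓ t) * γ t) ∧ ℓ 0 = ℓ 1 := by
  have h0 (t : ℝ) : γ t ≠ 0 := ne_zero_of_mem_annulus (h.mem t)
  have hG : Continuous fun t => deriv γ t / γ t :=
    (h.smooth.continuous_deriv (by norm_num)).div h.smooth.continuous h0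
  have hGγ (t : ℝ) : deriv γ t / γ t * γ t = deriv γ t := div_mul_cancel₀ _ (h0 t)
  obtain ⟨Γ, hΓ, -, hexp⟩ := exists_primitive_exp_eq convex_univ (mem_univ 0) (X := γ) hG
    (fun t _ => by
      rw [hGγ]
      exact (h.smooth.differentiable (by norm_num) t).hasDerivAt.hasDerivWithinAt)
    (Complex.exp_log (h0 0))
  replace hexp t : exp (Γ t) = γ t := hexp t trivial
  have hΓc : Continuous Γ := continuous_iff_continuousAt.2 fun t => (hΓ t).continuousAt
  have htrans (t : ℝ) : Γ (t + 1) = Γ t + (Γ 1 - Γ 0) := by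
    have := sub_eq_sub_of_exp_eq_exp isPreconnected_univ
      (L := fun t => Γ (t + 1)) (L' := Γ) (by fun_prop) hΓc.continuousOn
      (fun t _ => by rw [hexp, hexp, h.periodic]) (mem_univ t) (mem_univ 0)
    simp only [zero_add] at this
    linear_combination this
  have hne : Γ 1 - Γ 0 ≠ 0 := fun hc => h.not_nullhomotopic <|
    (isNullhomotopic_iff_of_lift (fun t _ => h.mem t) hΓc.continuousOn fun t _ => hexp t).2
      (sub_eq_zero.1 hc)
  obtain ⟨ℓ, hℓ, hℓexp, hclosed⟩ := exists_log_deriv_of_translation hG hΓ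
    (fun t => div_ne_zero (h.immersed t) (h0 t))
    (injective_of_exp_eq_periodic h.periodic h.injOn hexp htrans hne) htrans
  exact ⟨ℓ, hℓ, fun t => by rw [hℓexp, hGγ], hclosed⟩

lemma IsAngle.windsTrivially {η : Foliation} {ψ : ℂ → ℝ} (h : IsAngle η ψ 0) :
    WindsTrivially η := by
  intro γ hγ a ha
  obtain ⟨ℓ, hℓ, hderiv, hclosed⟩ := hγ.exists_log_deriv
  have hvel (t : ℝ) (ht : t ∈ Icc (0 : ℝ) 1) : velocity γ t = exp (ℓ t) * γ t := by
    rw [← hderiv]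
    exact (hγ.smooth.differentiable (by norm_num) t).derivWithin
      (uniqueDiffOn_Icc zero_lt_one t ht)
  have hγ01 : γ 1 = γ 0 := by simpa using hγ.periodic 0
  rw [ha.sub_eq h.isGlobalAngle hγ.smooth.continuous.continuousOn (fun t _ => hγ.mem t)
    hℓ.continuousOn hvel unitInterval.zero_mem unitInterval.one_mem, hγ01, hclosed]
  simp

/-! ### Markings -/

lemma IsCircleMarking.norm_eq {r : ℝ} (hr : 0 ≤ r) {M : Set ℂ} (h : IsCircleMarking r M) {z : ℂ}
    (hz : z ∈ M) : ‖z‖ = r := by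
  rcases h with rfl | ⟨n, a, b, -, -, -, -, rfl⟩
  · exact hz
  · obtain ⟨i, θ, -, rfl⟩ := hz
    rw [norm_mul, Complex.norm_exp_ofReal_mul_I, mul_one, Complex.norm_real, Real.norm_of_nonneg hr]

lemma IsCircleMarking.exists_interval {r : ℝ} (hr : 0 ≤ r) {M : Set ℂ} (h : IsCircleMarking r M) :
    ∃ p δ : ℝ, 0 < δ ∧ ∀ θ : ℝ, |θ - p| < δ → r * exp (θ * I) ∈ M := by
  rcases h with rfl | ⟨n, a, b, hn, hab, -, -, rfl⟩
  · refine ⟨0, 1, one_pos, fun θ _ => ?_⟩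
    rw [mem_ofPred_eq, norm_mul, Complex.norm_exp_ofReal_mul_I, mul_one, Complex.norm_real,
      Real.norm_of_nonneg hr]
  · have hlt := hab ⟨0, hn⟩
    refine ⟨(a ⟨0, hn⟩ + b ⟨0, hn⟩) / 2, (b ⟨0, hn⟩ - a ⟨0, hn⟩) / 2, by linarith, fun θ hθ => ?_⟩
    rw [abs_lt] at hθ
    exact ⟨⟨0, hn⟩, θ, ⟨by linarith [hθ.1], by linarith [hθ.2]⟩, rfl⟩

lemma IsMarking.norm_eq {M : Set ℂ} (h : IsMarking M) {z : ℂ} (hz : z ∈ M) :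
    ‖z‖ = 1 ∨ ‖z‖ = 2 := by
  obtain ⟨M₁, M₂, h₁, h₂, rfl⟩ := h
  exact hz.imp (h₁.norm_eq zero_le_one) (h₂.norm_eq zero_le_two)

lemma IsMarking.norm_eq_of_path {M : Set ℂ} (h : IsMarking M) {f : ℝ → ℂ}
    (hf : ContinuousOn f (Icc 0 1)) (hfM : ∀ t ∈ Icc (0 : ℝ) 1, f t ∈ M) {s t : ℝ}
    (hs : s ∈ Icc (0 : ℝ) 1) (ht : t ∈ Icc (0 : ℝ) 1) : ‖f s‖ = ‖f t‖ := by
  refine eq_of_forall_mem_zmultiples isPreconnected_Icc (f := fun t => ‖f t‖) hf.norm (p := 1)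
    (fun t ht => ?_) hs ht
  rcases h.norm_eq (hfM t ht) with h | h
  · exact ⟨1, by simp [h]⟩
  · exact ⟨2, by simp [h]⟩

lemma IsMarking.not_deformsInto {M : Set ℂ} (h : IsMarking M) {X : ℝ → ℂ} (hX : ‖X 0‖ ≠ ‖X 1‖) :
    ¬ DeformsInto M X := by
  rintro ⟨H, hH, -, hX0, hends, hlast⟩
  have zero_mem : (0 : ℝ) ∈ Icc (0 : ℝ) 1 := unitInterval.zero_mem
  have one_mem : (1 : ℝ) ∈ Icc (0 : ℝ) 1 := unitInterval.one_mem
  have hcont {t : ℝ} (ht : t ∈ Icc (0 : ℝ) 1) : ContinuousOn (fun s => H (s, t)) (Icc 0 1) :=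
    hH.comp (by fun_prop) fun s hs => ⟨hs, ht⟩
  have hleft := h.norm_eq_of_path (hcont zero_mem) (fun s hs => (hends s hs).1) zero_mem one_mem
  have hright := h.norm_eq_of_path (hcont one_mem) (fun s hs => (hends s hs).2) zero_mem one_mem
  have htop := h.norm_eq_of_path (f := fun t => H (1, t))
    (hH.comp (by fun_prop) fun t ht => ⟨one_mem, ht⟩) hlast zero_mem one_mem
  simp only [hX0 0 zero_mem, hX0 1 one_mem] at hleft hright
  exact hX (hleft.trans (htop.trans hright.symm))

/-! ### Coordinates at the boundary circles -/

/-- The boundary circles of the annulus, encoded by their radius `r` and a sign `σ`. The sign is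
chosen so that the coordinate `w` with `z = r e^{σ w}` identifies the universal cover of the annulus
with the strip `0 ≤ re w ≤ log 2` in such a way that the circle of radius `r` becomes the imaginary
axis and its reversed boundary orientation points upwards. -/
def IsSide (r σ : ℝ) : Prop := r = 1 ∧ σ = 1 ∨ r = 2 ∧ σ = -1

/-- The covering map of the coordinate at the boundary circle `(r, σ)`. -/
noncomputable def sideExp (r σ : ℝ) (w : ℂ) : ℂ := r * exp (σ * w)

lemma sideExp_ofReal_mul_I (r σ θ : ℝ) : sideExp r σ (θ * I) = r * exp ((σ * θ : ℝ) * I) := by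
  rw [sideExp]
  push_cast
  ring_nf

namespace IsSide

variable {r σ : ℝ}

lemma sq (h : IsSide r σ) : (σ : ℂ) * σ = 1 := by
  rcases h with ⟨-, rfl⟩ | ⟨-, rfl⟩ <;> norm_num

lemma ne_zero (h : IsSide r σ) : σ ≠ 0 := by
  rcases h with ⟨-, rfl⟩ | ⟨-, rfl⟩ <;> norm_num

lemma pos (h : IsSide r σ) : 0 < r := by
  rcases h with ⟨rfl, -⟩ | ⟨rfl, -⟩ <;> norm_num

lemma ofReal_ne_zero (h : IsSide r σ) : (r : ℂ) ≠ 0 := Complex.ofReal_ne_zero.2 h.pos.ne'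

lemma norm_sideExp (h : IsSide r σ) (w : ℂ) : ‖sideExp r σ w‖ = r * Real.exp (σ * w.re) := by
  rw [sideExp, norm_mul, Complex.norm_exp, Complex.norm_real, Real.norm_of_nonneg h.pos.le,
    Complex.re_ofReal_mul]

lemma sideExp_mem_annulus_iff (h : IsSide r σ) {w : ℂ} :
    sideExp r σ w ∈ annulus ↔ 0 ≤ w.re ∧ w.re ≤ Real.log 2 := by
  change 1 ≤ ‖_‖ ∧ ‖_‖ ≤ 2 ↔ _
  rw [h.norm_sideExp, Real.le_log_iff_exp_le two_pos, ← Real.one_le_exp_iff]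
  rcases h with ⟨rfl, rfl⟩ | ⟨rfl, rfl⟩
  · simp
  · have hpos := Real.exp_pos w.re
    rw [neg_one_mul, Real.exp_neg, ← div_eq_mul_inv, le_div_iff₀ hpos, div_le_iff₀ hpos, one_mul,
      le_mul_iff_one_le_right two_pos, and_comm]

lemma norm_sideExp_eq_iff (h : IsSide r σ) {w : ℂ} : ‖sideExp r σ w‖ = r ↔ w.re = 0 := by
  rw [h.norm_sideExp, mul_eq_left₀ h.pos.ne', Real.exp_eq_one_iff, mul_eq_zero,
    or_iff_right h.ne_zero]

lemma re_eq_log_two (h : IsSide r σ) {w : ℂ} (hw : ‖sideExp r σ w‖ = 1 ∨ ‖sideExp r σ w‖ = 2)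
    (hne : ‖sideExp r σ w‖ ≠ r) : w.re = Real.log 2 := by
  rw [h.norm_sideExp] at hw hne
  rw [← Real.exp_eq_exp, Real.exp_log two_pos]
  rcases h with ⟨rfl, rfl⟩ | ⟨rfl, rfl⟩
  · rw [one_mul, one_mul] at hw hne
    exact hw.resolve_left hne
  · have hone := hw.resolve_right hne
    rw [neg_one_mul, Real.exp_neg, ← div_eq_mul_inv, div_eq_one_iff_eq (Real.exp_ne_zero _)] at hone
    exact hone.symm

lemma exists_sideExp_eq (h : IsSide r σ) {z : ℂ} (hz : z ≠ 0) : ∃ w, sideExp r σ w = z := by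
  refine ⟨σ * Complex.log (z / r), ?_⟩
  rw [sideExp, ← mul_assoc, h.sq, one_mul, Complex.exp_log (div_ne_zero hz h.ofReal_ne_zero),
    mul_div_cancel₀ _ h.ofReal_ne_zero]

lemma reverseBoundary_eq (h : IsSide r σ) {z : ℂ} (hz : ‖z‖ = r) :
    reverseBoundary z = σ * I * z := by
  rcases h with ⟨rfl, rfl⟩ | ⟨rfl, rfl⟩
  · simp [reverseBoundary, hz]
  · simp [reverseBoundary, hz]

end IsSide

/-! ### A double pair for every marking -/

/-- The spiral from the point at angle `p` on the inner circle to the point at angle `q` on the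
outer circle; `p` and `q` are real numbers, so that `q - p` is the angle swept out. -/
noncomputable def crossingArc (p q : ℝ) : ℝ → ℂ :=
  spiral (p * I) (Real.log 2 + (q - p : ℝ) * I)

lemma re_crossingArc_slope (θ : ℝ) : (Real.log 2 + θ * I).re = Real.log 2 := by
  rw [Complex.add_re, Complex.ofReal_re, Complex.re_ofReal_mul, Complex.I_re, mul_zero, add_zero]

lemma crossingArc_zero (p q : ℝ) : crossingArc p q 0 = exp (p * I) := by
  simp [crossingArc, spiral]

lemma exp_log_two_add (z : ℂ) : exp (Real.log 2 + z) = 2 * exp z := by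
  rw [Complex.exp_add, ← Complex.ofReal_exp, Real.exp_log two_pos, Complex.ofReal_ofNat]

lemma crossingArc_one (p q : ℝ) : crossingArc p q 1 = 2 * exp (q * I) := by
  rw [crossingArc, spiral, ← exp_log_two_add]
  push_cast
  ring_nf

lemma norm_crossingArc (p q u : ℝ) : ‖crossingArc p q u‖ = 2 ^ u := by
  rw [crossingArc, spiral, Complex.norm_exp, Complex.add_re, Complex.re_mul_ofReal,
    re_crossingArc_slope, Complex.re_ofReal_mul, Complex.I_re, mul_zero, zero_add,
    Real.rpow_def_of_pos two_pos]

lemma isArc_crossingArc {M : Set ℂ} (hM : IsMarking M) {p q : ℝ} (hp : exp (p * I) ∈ M)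
    (hq : 2 * exp (q * I) ∈ M) : IsArc M (crossingArc p q) where
  toIsImmersedCurve := by
    refine isImmersedCurve_spiral (fun h => ?_) fun u hu => ?_
    · have hre := re_crossingArc_slope (q - p)
      rw [h, Complex.zero_re] at hre
      exact (Real.log_pos one_lt_two).ne hre
    · change 1 ≤ ‖crossingArc p q u‖ ∧ ‖crossingArc p q u‖ ≤ 2
      rw [norm_crossingArc]
      exact ⟨Real.one_le_rpow one_le_two hu.1, Real.rpow_le_self_of_one_le one_le_two hu.2⟩
  injOn u _ v _ huv := by
    have hnorm := congrArg norm huv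
    simp only [norm_crossingArc] at hnorm
    exact (Real.strictMono_rpow_of_base_gt_one one_lt_two).injective hnorm
  interior u hu := by
    rw [norm_crossingArc]
    exact ⟨Real.one_lt_rpow one_lt_two hu.1, Real.rpow_lt_self_of_one_lt one_lt_two hu.2⟩
  endpoints := ⟨(crossingArc_zero p q).symm ▸ hp, (crossingArc_one p q).symm ▸ hq⟩
  transverse u hu c hc := by
    have hu' : u ∈ Icc (0 : ℝ) 1 := by rcases hu with rfl | rfl <;> simp
    rw [crossingArc, velocity_spiral _ _ hu', ← mul_assoc] at hc
    have hre := congrArg Complex.re (mul_right_cancel₀ (spiral_ne_zero _ _ _) hc)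
    rw [re_crossingArc_slope, Complex.re_ofReal_mul, Complex.I_re, mul_zero] at hre
    exact (Real.log_pos one_lt_two).ne' hre
  essential := hM.not_deformsInto (by rw [norm_crossingArc, norm_crossingArc]; norm_num)

lemma disjoint_crossingArc {p q p' q' : ℝ} (hp : p' - p ∈ Ioo 0 (2 * π))
    (hq : q' - q ∈ Ioo 0 (2 * π)) :
    Disjoint (crossingArc p q '' Icc 0 1) (crossingArc p' q' '' Icc 0 1) := by
  rw [Set.disjoint_left]
  rintro _ ⟨u, hu, rfl⟩ ⟨v, -, huv⟩
  have hnorm := congrArg norm huv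
  rw [norm_crossingArc, norm_crossingArc] at hnorm
  obtain rfl : v = u := (Real.strictMono_rpow_of_base_gt_one one_lt_two).injective hnorm
  obtain ⟨n, hn⟩ := Complex.exp_eq_exp_iff_exists_int.1 huv
  have hturn : AffineMap.lineMap (p' - p) (q' - q) v = n * (2 * π) := by
    have hC : ((AffineMap.lineMap (p' - p) (q' - q) v : ℝ) : ℂ) * I = (n * (2 * π) : ℝ) * I := by
      rw [AffineMap.lineMap_apply_ring']
      push_cast at hn ⊢
      linear_combination hn
    exact_mod_cast mul_right_cancel₀ Complex.I_ne_zero hC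
  have hmem := (convex_Ioo 0 (2 * π)).lineMap_mem hp hq hu
  rw [hturn] at hmem
  have hpos : 0 < n := by exact_mod_cast pos_of_mul_pos_left hmem.1 Real.two_pi_pos.le
  have hlt : n < 1 := by
    exact_mod_cast lt_of_mul_lt_mul_right (hmem.2.trans_eq (one_mul _).symm) Real.two_pi_pos.le
  omega

/-- The path on the boundary circle `(r, σ)` that runs from the coordinate `a i` to `b i`. -/
noncomputable def boundaryArc (r σ a b : ℝ) : ℝ → ℂ :=
  spiral (Real.log r + (σ * a : ℝ) * I) ((σ * (b - a) : ℝ) * I)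

lemma IsSide.boundaryArc_eq {r σ : ℝ} (h : IsSide r σ) (a b u : ℝ) :
    boundaryArc r σ a b u = sideExp r σ ((AffineMap.lineMap a b u : ℝ) * I) := by
  rw [boundaryArc, spiral, add_assoc, Complex.exp_add, ← Complex.ofReal_exp, Real.exp_log h.pos,
    sideExp, AffineMap.lineMap_apply_ring']
  push_cast
  ring_nf

lemma IsSide.isBoundaryPath_boundaryArc {r σ : ℝ} (h : IsSide r σ) {M : Set ℂ} {X Y : ℝ → ℂ}
    {s t a b : ℝ} (hab : a < b) (hM : ∀ θ ∈ Icc a b, sideExp r σ (θ * I) ∈ M)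
    (hs : s = 0 ∨ s = 1) (ht : t = 0 ∨ t = 1) (hX : sideExp r σ (a * I) = X s)
    (hY : sideExp r σ (b * I) = Y t) : IsBoundaryPath M X Y (boundaryArc r σ a b) s t where
  toIsImmersedCurve := by
    refine isImmersedCurve_spiral (mul_ne_zero ?_ Complex.I_ne_zero) fun u _ => ?_
    · exact Complex.ofReal_ne_zero.2 (mul_ne_zero h.ne_zero (sub_pos.2 hab).ne')
    · change boundaryArc r σ a b u ∈ annulus
      rw [h.boundaryArc_eq, h.sideExp_mem_annulus_iff, Complex.re_ofReal_mul, Complex.I_re,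
        mul_zero]
      exact ⟨le_rfl, Real.log_nonneg one_le_two⟩
  mem_marking u hu := by
    rw [h.boundaryArc_eq]
    exact hM _ ((convex_Icc a b).lineMap_mem (left_mem_Icc.2 hab.le) (right_mem_Icc.2 hab.le) hu)
  direction u hu := by
    refine ⟨b - a, sub_pos.2 hab, ?_⟩
    rw [h.reverseBoundary_eq (by
      rw [h.boundaryArc_eq, h.norm_sideExp_eq_iff, Complex.re_ofReal_mul, Complex.I_re, mul_zero]),
      boundaryArc, velocity_spiral _ _ hu]
    push_cast
    ring
  source := hs
  target := ht
  start := by rw [h.boundaryArc_eq, AffineMap.lineMap_apply_zero, hX]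
  finish := by rw [h.boundaryArc_eq, AffineMap.lineMap_apply_one, hY]

lemma IsMarking.isDoublePair_crossingArc {M : Set ℂ} (hM : IsMarking M) {p q ε : ℝ} (hε : 0 < ε)
    (hεπ : ε < π) (hinner : ∀ θ ∈ Icc p (p + ε), exp (θ * I) ∈ M)
    (houter : ∀ θ ∈ Icc (q - ε) q, 2 * exp (θ * I) ∈ M) :
    IsDoublePair M (crossingArc p q) (crossingArc (p + ε) (q - ε + 2 * π))
      (boundaryArc 1 1 p (p + ε)) (boundaryArc 2 (-1) (-q) (-q + ε)) 0 0 1 1 := by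
  have hperiod : 2 * exp ((q - ε + 2 * π : ℝ) * I) = 2 * exp ((q - ε : ℝ) * I) := by
    rw [Complex.ofReal_add, add_mul, Complex.exp_add]
    push_cast
    rw [Complex.exp_two_pi_mul_I, mul_one]
  have hle : p ≤ p + ε := by linarith
  have hle' : q - ε ≤ q := by linarith
  refine
    { arc_left := isArc_crossingArc hM (hinner p ⟨le_rfl, hle⟩) (houter q ⟨hle', le_rfl⟩)
      arc_right := isArc_crossingArc hM (hinner _ ⟨hle, le_rfl⟩)
        (hperiod ▸ houter _ ⟨le_rfl, hle'⟩)
      disjoint := disjoint_crossingArc ⟨by linarith, by linarith⟩ ⟨by linarith, by linarith⟩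
      path := IsSide.isBoundaryPath_boundaryArc (Or.inl ⟨rfl, rfl⟩) (by linarith)
        (fun θ hθ => ?_) (Or.inl rfl) (Or.inl rfl) ?_ ?_
      path' := IsSide.isBoundaryPath_boundaryArc (Or.inr ⟨rfl, rfl⟩) (by linarith)
        (fun θ hθ => ?_) (Or.inr rfl) (Or.inr rfl) ?_ ?_
      distinct := ⟨0, unitInterval.zero_mem, fun h => ?_⟩
      loop := by simp }
  · simpa [sideExp] using hinner θ hθ
  · simp [sideExp, crossingArc_zero]
  · simp [sideExp, crossingArc_zero]
  · simpa [sideExp] using houter (-θ) ⟨by linarith [hθ.2], by linarith [hθ.1]⟩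
  · simp [sideExp, crossingArc_one]
  · rw [crossingArc_one, hperiod, sideExp_ofReal_mul_I]
    congr 4
    ring
  · have hnorm := congrArg norm h
    rw [IsSide.boundaryArc_eq (Or.inl ⟨rfl, rfl⟩), IsSide.boundaryArc_eq (Or.inr ⟨rfl, rfl⟩),
      IsSide.norm_sideExp (Or.inl ⟨rfl, rfl⟩), IsSide.norm_sideExp (Or.inr ⟨rfl, rfl⟩)] at hnorm
    simp at hnorm

lemma IsMarking.exists_isDoublePair {M : Set ℂ} (hM : IsMarking M) :
    ∃ p q ε : ℝ, 0 < ε ∧ IsDoublePair M (crossingArc p q) (crossingArc (p + ε) (q - ε + 2 * π))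
      (boundaryArc 1 1 p (p + ε)) (boundaryArc 2 (-1) (-q) (-q + ε)) 0 0 1 1 := by
  obtain ⟨M₁, M₂, h₁, h₂, rfl⟩ := id hM
  obtain ⟨p, δ₁, hδ₁, hp⟩ := h₁.exists_interval zero_le_one
  obtain ⟨q, δ₂, hδ₂, hq⟩ := h₂.exists_interval zero_le_two
  obtain ⟨ε, hε, hεlt⟩ := exists_between (lt_min (lt_min hδ₁ hδ₂) pi_pos)
  obtain ⟨⟨hε₁, hε₂⟩, hεπ⟩ : (ε < δ₁ ∧ ε < δ₂) ∧ ε < π := by simpa only [lt_min_iff] using hεlt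
  refine ⟨p, q, ε, hε, hM.isDoublePair_crossingArc hε hεπ (fun θ hθ => Or.inl ?_)
    (fun θ hθ => Or.inr ?_)⟩
  · simpa using hp θ (abs_lt.2 ⟨by linarith [hθ.1], by linarith [hθ.2]⟩)
  · simpa using hq θ (abs_lt.2 ⟨by linarith [hθ.1], by linarith [hθ.2]⟩)

lemma intersectionIndex_spiral (ψ : ℂ → ℝ) {A B A' w w' : ℂ} {e u v : ℝ} (hB : 0 < B.re)
    (he : e ≠ 0) (hu : u ∈ Icc (0 : ℝ) 1) (hv : v ∈ Icc (0 : ℝ) 1) (hw : A + B * u = w)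
    (hw' : A' + e * I * v = w') (hmeet : exp w' = exp w) :
    intersectionIndex (velocity (spiral A B) u) (velocity (spiral A' (e * I)) v)
      (ψ (A + B * u) + (π / 2 - arg B)) (ψ (A' + e * I * v) + (π / 2 - arg (e * I))) =
    (ψ w' - ψ w + π / 2 - arg (e * I)) / π := by
  rw [intersectionIndex, velocity_spiral _ _ hu, velocity_spiral _ _ hv, spiral, spiral, hw, hw',
    hmeet, ccwAngle_mul_mul (Complex.exp_ne_zero _), ccwAngle_real_mul_right he, ccwAngle_I hB]
  ring

lemma IsAngle.eq_zero_of_isBalanced {η : Foliation} {ψ : ℂ → ℝ} {d : ℤ} (h : IsAngle η ψ d)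
    {M : Set ℂ} (hM : IsMarking M) (hb : IsBalanced M η) : d = 0 := by
  obtain ⟨p, q, ε, hε, hpair⟩ := hM.exists_isDoublePair
  have zero_mem : (0 : ℝ) ∈ Icc (0 : ℝ) 1 := unitInterval.zero_mem
  have one_mem : (1 : ℝ) ∈ Icc (0 : ℝ) 1 := unitInterval.one_mem
  have hre (θ : ℝ) : 0 < (Real.log 2 + θ * I).re :=
    (Real.log_pos one_lt_two).trans_eq (re_crossingArc_slope θ).symm
  have hinner : (1 : ℝ) * (p + ε - p) ≠ 0 := by simp [hε.ne']
  have houter : (-1 : ℝ) * (-q + ε - -q) ≠ 0 := by simp [hε.ne']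
  have hdeg := hb _ _ _ _ _ _ _ _ hpair _ _ _ _ (h.isGrading_spiral _ _)
    (h.isGrading_spiral _ _) (h.isGrading_spiral _ _) (h.isGrading_spiral _ _)
  rw [pathDegree, pathDegree, crossingArc, crossingArc, boundaryArc, boundaryArc,
    intersectionIndex_spiral ψ (w := p * I) (w' := p * I) (hre _) hinner zero_mem zero_mem
      (by simp) (by simp) rfl,
    intersectionIndex_spiral ψ (w := (p + ε) * I) (w' := (p + ε) * I) (hre _) hinner zero_mem
      one_mem (by simp) (by rw [Real.log_one]; push_cast; ring) rfl,
    intersectionIndex_spiral ψ (w := Real.log 2 + q * I) (w' := Real.log 2 + q * I) (hre _) houter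
      one_mem zero_mem (by push_cast; ring) (by simp) rfl,
    intersectionIndex_spiral ψ (w := Real.log 2 + (q - ε) * I + 2 * π * I)
      (w' := Real.log 2 + (q - ε) * I) (hre _) houter one_mem one_mem (by push_cast; ring)
      (by push_cast; ring) (Complex.exp_periodic _).symm,
    h.add_two_pi_mul_I] at hdeg
  field_simp at hdeg
  have hzero : (d : ℝ) * π = 0 := by linarith
  exact_mod_cast (mul_eq_zero.1 hzero).resolve_right Real.pi_ne_zero

/-! ### Lifts of curves to the strip -/

/-- `Γ` is a lift of the curve `X` in the coordinate of the side `(r, σ)`, and has the derivative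
`G`. -/
structure IsStripLift (r σ : ℝ) (X Γ G : ℝ → ℂ) : Prop where
  side : IsSide r σ
  continuous : Continuous G
  hasDerivAt : ∀ t, HasDerivAt Γ (G t) t
  eq_sideExp : ∀ t ∈ Icc (0 : ℝ) 1, X t = sideExp r σ (Γ t)

lemma IsImmersedCurve.continuousOn_velocity {X : ℝ → ℂ} (hX : IsImmersedCurve X) :
    ContinuousOn (velocity X) (Icc 0 1) :=
  hX.smooth.continuousOn_derivWithin (uniqueDiffOn_Icc zero_lt_one) (by norm_num)

lemma IsImmersedCurve.exists_stripLift {X : ℝ → ℂ} (hX : IsImmersedCurve X) {r σ : ℝ}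
    (h : IsSide r σ) {s : ℝ} (hs : s ∈ Icc (0 : ℝ) 1) {w : ℂ} (hw : X s = sideExp r σ w) :
    ∃ Γ G, IsStripLift r σ X Γ G ∧ Γ s = w := by
  have hne (t : ℝ) (ht : t ∈ Icc (0 : ℝ) 1) : X t ≠ 0 := ne_zero_of_mem_annulus (hX.mem t ht)
  set G : ℝ → ℂ := IccExtend zero_le_one ((Icc 0 1).domRestrict fun t => velocity X t / X t)
  have hG : Continuous G := (continuousOn_iff_continuous_domRestrict.1
    (hX.continuousOn_velocity.div hX.smooth.continuousOn hne)).Icc_extend'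
  have hGX (t : ℝ) (ht : t ∈ Icc (0 : ℝ) 1) : G t * X t = velocity X t := by
    have : G t = velocity X t / X t := IccExtend_of_mem _ _ ht
    rw [this, div_mul_cancel₀ _ (hne t ht)]
  obtain ⟨Γ, hΓ, hΓs, hexp⟩ := exists_primitive_exp_eq (convex_Icc (0 : ℝ) 1)
    hs (X := fun t => X t / r) hG (fun t ht => by
      rw [← mul_div_assoc, hGX t ht]
      exact (hX.smooth.differentiableOn (by norm_num) t ht).hasDerivWithinAt.div_const (r : ℂ))
    (w := σ * w) (by rw [hw, sideExp, mul_div_cancel_left₀ _ h.ofReal_ne_zero])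
  refine ⟨fun t => σ * Γ t, fun t => σ * G t, ⟨h, by fun_prop, fun t => (hΓ t).const_mul _,
    fun t ht => ?_⟩, ?_⟩
  · rw [sideExp, ← mul_assoc, h.sq, one_mul, hexp t ht, mul_div_cancel₀ _ h.ofReal_ne_zero]
  · simp only [hΓs, ← mul_assoc, h.sq, one_mul]

lemma mul_deriv_nonneg_of_isMinOn {f : ℝ → ℝ} {f' a y : ℝ} {s : Set ℝ} (hs : Convex ℝ s)
    (ha : a ∈ s) (hy : y ∈ s) (hmin : IsMinOn f s a) (hf : HasDerivAt f f' a) :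
    0 ≤ (y - a) * f' := by
  simpa using hmin.localize.hasFDerivWithinAt_nonneg hf.hasFDerivAt.hasFDerivWithinAt
    (sub_mem_posTangentConeAt_of_segment_subset (hs.segment_subset ha hy))

namespace IsStripLift

variable {r σ : ℝ} {X Γ G : ℝ → ℂ}

lemma continuous_lift (h : IsStripLift r σ X Γ G) : Continuous Γ :=
  continuous_iff_continuousAt.2 fun t => (h.hasDerivAt t).continuousAt

lemma hasDerivAt_re (h : IsStripLift r σ X Γ G) (t : ℝ) :
    HasDerivAt (fun t => (Γ t).re) (G t).re t :=
  Complex.reCLM.hasFDerivAt.comp_hasDerivAt t (h.hasDerivAt t)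

lemma velocity_eq (h : IsStripLift r σ X Γ G) {t : ℝ} (ht : t ∈ Icc (0 : ℝ) 1) :
    velocity X t = σ * G t * X t := by
  have hderiv : HasDerivAt (fun t => sideExp r σ (Γ t)) (σ * G t * sideExp r σ (Γ t)) t := by
    refine (((h.hasDerivAt t).const_mul (σ : ℂ)).cexp.const_mul (r : ℂ)).congr_deriv ?_
    rw [sideExp]
    ring
  rw [h.eq_sideExp t ht]
  exact (hderiv.hasDerivWithinAt.congr h.eq_sideExp (h.eq_sideExp t ht)).derivWithin
    (uniqueDiffOn_Icc zero_lt_one t ht)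

lemma re_mem_Icc (h : IsStripLift r σ X Γ G) (hX : IsImmersedCurve X) {t : ℝ}
    (ht : t ∈ Icc (0 : ℝ) 1) : (Γ t).re ∈ Icc 0 (Real.log 2) := by
  rw [mem_Icc, ← h.side.sideExp_mem_annulus_iff, ← h.eq_sideExp t ht]
  exact hX.mem t ht

lemma norm_eq_iff (h : IsStripLift r σ X Γ G) {t : ℝ} (ht : t ∈ Icc (0 : ℝ) 1) :
    ‖X t‖ = r ↔ (Γ t).re = 0 := by
  rw [h.eq_sideExp t ht, h.side.norm_sideExp_eq_iff]

lemma deriv_ne_zero (h : IsStripLift r σ X Γ G) (hX : IsImmersedCurve X) {t : ℝ}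
    (ht : t ∈ Icc (0 : ℝ) 1) : G t ≠ 0 := by
  intro h0
  apply hX.immersed t ht
  rw [h.velocity_eq ht, h0, mul_zero, zero_mul]

lemma injOn (h : IsStripLift r σ X Γ G) (hX : InjOn X (Icc 0 1)) : InjOn Γ (Icc 0 1) := by
  intro a ha b hb hab
  apply hX ha hb
  rw [h.eq_sideExp a ha, h.eq_sideExp b hb, hab]

variable {M : Set ℂ}

lemma re_deriv_ne_zero (h : IsStripLift r σ X Γ G) (hX : IsArc M X) {t : ℝ}
    (ht : t = 0 ∨ t = 1) : (G t).re ≠ 0 := by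
  have ht' : t ∈ Icc (0 : ℝ) 1 := by rcases ht with rfl | rfl <;> simp
  intro h0
  apply hX.transverse t ht (σ * (G t).im)
  have hG : ((G t).im : ℂ) * I = G t := by apply Complex.ext <;> simp [h0]
  rw [h.velocity_eq ht', Complex.ofReal_mul]
  linear_combination -(σ * X t) * hG

lemma re_deriv_zero_pos (h : IsStripLift r σ X Γ G) (hX : IsArc M X) (h0 : (Γ 0).re = 0) :
    0 < (G 0).re := by
  have hmin : IsMinOn (fun t => (Γ t).re) (Icc 0 1) 0 := fun t ht => by
    simpa only [h0, mem_ofPred_eq] using (h.re_mem_Icc hX.toIsImmersedCurve ht).1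
  have := mul_deriv_nonneg_of_isMinOn (convex_Icc 0 1) unitInterval.zero_mem
    unitInterval.one_mem hmin (h.hasDerivAt_re 0)
  exact lt_of_le_of_ne (by linarith) (h.re_deriv_ne_zero hX (Or.inl rfl)).symm

lemma re_deriv_one_neg (h : IsStripLift r σ X Γ G) (hX : IsArc M X) (h1 : (Γ 1).re = 0) :
    (G 1).re < 0 := by
  have hmin : IsMinOn (fun t => (Γ t).re) (Icc 0 1) 1 := fun t ht => by
    simpa only [h1, mem_ofPred_eq] using (h.re_mem_Icc hX.toIsImmersedCurve ht).1
  have := mul_deriv_nonneg_of_isMinOn (convex_Icc 0 1) unitInterval.one_mem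
    unitInterval.zero_mem hmin (h.hasDerivAt_re 1)
  exact lt_of_le_of_ne (by linarith) (h.re_deriv_ne_zero hX (Or.inr rfl))

lemma re_deriv_one_pos (h : IsStripLift r σ X Γ G) (hX : IsArc M X)
    (h1 : (Γ 1).re = Real.log 2) : 0 < (G 1).re := by
  have hmin : IsMinOn (fun t => -(Γ t).re) (Icc 0 1) 1 := fun t ht => by
    simpa only [h1, mem_ofPred_eq, neg_le_neg_iff] using
      (h.re_mem_Icc hX.toIsImmersedCurve ht).2
  have := mul_deriv_nonneg_of_isMinOn (convex_Icc 0 1) unitInterval.one_mem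
    unitInterval.zero_mem hmin (h.hasDerivAt_re 1).neg
  exact lt_of_le_of_ne (by linarith) (h.re_deriv_ne_zero hX (Or.inr rfl)).symm

end IsStripLift

/-! ### Indices at the ends of arcs -/

/-- The index of an arc `X` with the grading `x` and the boundary at the end `X s`, times `π`: the
boundary direction is given the grading that corresponds to the global angle `Ψ` of the
foliation. -/
noncomputable def endIndex (Ψ : ℂ → ℝ) (X : ℝ → ℂ) (x : ℝ → ℝ) (s : ℝ) : ℝ :=
  -x s + Ψ (X s) + ccwAngle (velocity X s) (I * X s)

lemma endIndex_one_sub_endIndex_zero {η : Foliation} {Ψ : ℂ → ℝ} (hη : IsGlobalAngle η Ψ)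
    {r σ : ℝ} {X Γ G : ℝ → ℂ} (h : IsStripLift r σ X Γ G) (hX : IsImmersedCurve X) {x : ℝ → ℝ}
    (hx : IsGrading η X x) {ℓ : ℝ → ℂ} (hℓ : ContinuousOn ℓ (Icc 0 1))
    (hexp : ∀ t ∈ Icc (0 : ℝ) 1, exp (ℓ t) = G t) :
    endIndex Ψ X x 1 - endIndex Ψ X x 0 =
      (ℓ 1).im - (ℓ 0).im + ccwAngle (G 1) I - ccwAngle (G 0) I := by
  have hσ : (σ : ℂ) ≠ 0 := Complex.ofReal_ne_zero.2 h.side.ne_zero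
  have hgrad := hx.sub_eq hη hX.smooth.continuousOn hX.mem (ℓ := fun t => Complex.log σ + ℓ t)
    (by fun_prop)
    (fun t ht => by rw [Complex.exp_add, Complex.exp_log hσ, hexp t ht, h.velocity_eq ht])
    unitInterval.one_mem unitInterval.zero_mem
  have hccw {t : ℝ} (ht : t ∈ Icc (0 : ℝ) 1) :
      ccwAngle (velocity X t) (I * X t) = ccwAngle (G t) I := by
    rw [h.velocity_eq ht, ccwAngle_mul_mul (ne_zero_of_mem_annulus (hX.mem t ht)),
      ccwAngle_real_mul_left h.side.ne_zero]
  rw [endIndex, endIndex, hccw unitInterval.one_mem, hccw unitInterval.zero_mem]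
  simp only [Complex.add_im] at hgrad
  linarith

lemma IsMarking.exists_isSide {M : Set ℂ} (hM : IsMarking M) {z : ℂ} (hz : z ∈ M) :
    ∃ σ, IsSide ‖z‖ σ :=
  (hM.norm_eq hz).elim (fun h => ⟨1, Or.inl ⟨h, rfl⟩⟩) fun h => ⟨-1, Or.inr ⟨h, rfl⟩⟩

lemma endIndex_one_eq_of_crossing {η : Foliation} {Ψ : ℂ → ℝ} (hη : IsGlobalAngle η Ψ) {M : Set ℂ}
    (hM : IsMarking M) {X : ℝ → ℂ} (hX : IsArc M X) (hne : ‖X 0‖ ≠ ‖X 1‖) {x : ℝ → ℝ}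
    (hx : IsGrading η X x) : endIndex Ψ X x 1 = endIndex Ψ X x 0 := by
  have hX' := hX.toIsImmersedCurve
  have zero_mem : (0 : ℝ) ∈ Icc (0 : ℝ) 1 := unitInterval.zero_mem
  have one_mem : (1 : ℝ) ∈ Icc (0 : ℝ) 1 := unitInterval.one_mem
  obtain ⟨σ, hside⟩ := hM.exists_isSide hX.endpoints.1
  obtain ⟨w, hw⟩ := hside.exists_sideExp_eq (ne_zero_of_mem_annulus (hX.mem 0 zero_mem))
  obtain ⟨Γ, G, h, -⟩ := hX'.exists_stripLift hside zero_mem hw.symm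
  have h0 : (Γ 0).re = 0 := (h.norm_eq_iff zero_mem).1 rfl
  have h1 : (Γ 1).re = Real.log 2 := by
    apply h.side.re_eq_log_two <;> rw [← h.eq_sideExp 1 one_mem]
    exacts [hM.norm_eq hX.endpoints.2, hne.symm]
  have hpos₀ := h.re_deriv_zero_pos hX h0
  have hpos₁ := h.re_deriv_one_pos hX h1
  obtain ⟨ℓ, hℓ, hexp, hturn⟩ := exists_log_deriv_of_crossing h.continuous h.hasDerivAt
    (fun t ht => h.deriv_ne_zero hX' ht) (h.injOn hX.injOn)
    (fun t ht => h0.trans_le (h.re_mem_Icc hX' ht).1) (fun t ht => h1 ▸ (h.re_mem_Icc hX' ht).2)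
    hpos₀.le hpos₁.le
  have := endIndex_one_sub_endIndex_zero hη h hX' hx hℓ hexp
  rw [hturn, ccwAngle_I hpos₀, ccwAngle_I hpos₁] at this
  linarith

lemma endIndex_eq_of_crossing {η : Foliation} {Ψ : ℂ → ℝ} (hη : IsGlobalAngle η Ψ) {M : Set ℂ}
    (hM : IsMarking M) {X : ℝ → ℂ} (hX : IsArc M X) {s : ℝ} (hs : s = 0 ∨ s = 1)
    (hne : ‖X s‖ ≠ ‖X (1 - s)‖) {x : ℝ → ℝ} (hx : IsGrading η X x) :
    endIndex Ψ X x (1 - s) = endIndex Ψ X x s := by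
  rcases hs with rfl | rfl
  · rw [sub_zero] at hne ⊢
    exact endIndex_one_eq_of_crossing hη hM hX hne hx
  · rw [sub_self] at hne ⊢
    exact (endIndex_one_eq_of_crossing hη hM hX hne.symm hx).symm

lemma endIndex_eq_of_returning {η : Foliation} {Ψ : ℂ → ℝ} (hη : IsGlobalAngle η Ψ) {M : Set ℂ}
    {r σ : ℝ} {X Γ G : ℝ → ℂ} (h : IsStripLift r σ X Γ G) (hX : IsArc M X)
    (hre : ∀ u, u = 0 ∨ u = 1 → (Γ u).re = 0) {x : ℝ → ℝ} (hx : IsGrading η X x)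
    {s : ℝ} (hs : s = 0 ∨ s = 1) (hlt : (Γ s).im < (Γ (1 - s)).im) :
    endIndex Ψ X x (1 - s) = endIndex Ψ X x s + π := by
  have hX' := hX.toIsImmersedCurve
  have h0 : (Γ 0).re = 0 := hre 0 (Or.inl rfl)
  have h1 : (Γ 1).re = 0 := hre 1 (Or.inr rfl)
  have hpos := h.re_deriv_zero_pos hX h0
  have hneg := h.re_deriv_one_neg hX h1
  obtain ⟨ℓ, hℓ, hexp, hup, hdown⟩ := exists_log_deriv_of_returning h.continuous h.hasDerivAt
    (fun t ht => h.deriv_ne_zero hX' ht) (h.injOn hX.injOn)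
    (fun t ht => h0.trans_le (h.re_mem_Icc hX' ht).1) (h1.trans h0.symm) hpos.le hneg.le
  have hccw : ccwAngle (G 1) I = π / 2 - arg (-G 1) := by
    rw [← ccwAngle_I (by simpa using hneg), ← ccwAngle_real_mul_left (neg_ne_zero.2 one_ne_zero),
      Complex.ofReal_neg, Complex.ofReal_one, neg_one_mul]
  have := endIndex_one_sub_endIndex_zero hη h hX' hx hℓ hexp
  rw [ccwAngle_I hpos, hccw] at this
  rcases hs with rfl | rfl
  · rw [sub_zero] at hlt ⊢
    linarith [hup hlt]
  · rw [sub_self] at hlt ⊢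
    linarith [hdown hlt]

lemma IsBoundaryPath.exists_isSide {M : Set ℂ} (hM : IsMarking M) {X Y γ : ℝ → ℂ} {s t : ℝ}
    (h : IsBoundaryPath M X Y γ s t) :
    ∃ r σ, IsSide r σ ∧ ∀ u ∈ Icc (0 : ℝ) 1, ‖γ u‖ = r := by
  obtain ⟨σ, hσ⟩ := hM.exists_isSide (h.mem_marking 0 unitInterval.zero_mem)
  exact ⟨_, σ, hσ, fun u hu =>
    hM.norm_eq_of_path h.smooth.continuousOn h.mem_marking hu unitInterval.zero_mem⟩

lemma IsBoundaryPath.exists_velocity_eq {M : Set ℂ} (hM : IsMarking M) {X Y γ : ℝ → ℂ} {s t : ℝ}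
    (h : IsBoundaryPath M X Y γ s t) :
    ∃ σ ≠ (0 : ℝ), ∀ u ∈ Icc (0 : ℝ) 1, ∃ c > (0 : ℝ), velocity γ u = c * (σ * I) * γ u := by
  obtain ⟨r, σ, hside, hnorm⟩ := h.exists_isSide hM
  refine ⟨σ, hside.ne_zero, fun u hu => ?_⟩
  obtain ⟨c, hc, hv⟩ := h.direction u hu
  refine ⟨c, hc, ?_⟩
  rw [hv, hside.reverseBoundary_eq (hnorm u hu)]
  ring

lemma IsBoundaryPath.sub_eq_of_isGrading {η : Foliation} {Ψ : ℂ → ℝ} (hη : IsGlobalAngle η Ψ)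
    {M : Set ℂ} (hM : IsMarking M) {X Y γ : ℝ → ℂ} {s t : ℝ} (h : IsBoundaryPath M X Y γ s t)
    {g : ℝ → ℝ} (hg : IsGrading η γ g) : g 1 - g 0 = Ψ (Y t) - Ψ (X s) := by
  have zero_mem : (0 : ℝ) ∈ Icc (0 : ℝ) 1 := unitInterval.zero_mem
  have one_mem : (1 : ℝ) ∈ Icc (0 : ℝ) 1 := unitInterval.one_mem
  have hne (u : ℝ) (hu : u ∈ Icc (0 : ℝ) 1) : γ u ≠ 0 := ne_zero_of_mem_annulus (h.mem u hu)
  obtain ⟨σ, hσ, hv⟩ := h.exists_velocity_eq hM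
  choose! c hc hv using hv
  have hdir (u : ℝ) (hu : u ∈ Icc (0 : ℝ) 1) : velocity γ u / γ u = c u * (σ * I) := by
    rw [hv u hu, mul_div_cancel_right₀ _ (hne u hu)]
  have hslit (u : ℝ) (hu : u ∈ Icc (0 : ℝ) 1) : velocity γ u / γ u ∈ Complex.slitPlane := by
    rw [hdir u hu, Complex.mem_slitPlane_iff]
    right
    simpa using ⟨(hc u hu).ne', hσ⟩
  have harg (u : ℝ) (hu : u ∈ Icc (0 : ℝ) 1) :
      (Complex.log (velocity γ u / γ u)).im = arg (σ * I) := by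
    rw [Complex.log_im, hdir u hu, Complex.arg_real_mul _ (hc u hu)]
  have hgrad := hg.sub_eq hη h.smooth.continuousOn h.mem
    (ℓ := fun u => Complex.log (velocity γ u / γ u))
    ((h.continuousOn_velocity.div h.smooth.continuousOn hne).clog hslit)
    (fun u hu => by rw [Complex.exp_log (div_ne_zero (h.immersed u hu) (hne u hu)),
      div_mul_cancel₀ _ (hne u hu)]) one_mem zero_mem
  rwa [harg 1 one_mem, harg 0 zero_mem, sub_self, sub_zero, h.start, h.finish] at hgrad

lemma pathDegree_eq {η : Foliation} {Ψ : ℂ → ℝ} (hη : IsGlobalAngle η Ψ) {M : Set ℂ}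
    (hM : IsMarking M) {X Y γ : ℝ → ℂ} {s t : ℝ} (h : IsBoundaryPath M X Y γ s t)
    (x y : ℝ → ℝ) {g : ℝ → ℝ} (hg : IsGrading η γ g) :
    pathDegree X Y γ s t x y g = (endIndex Ψ X x s - endIndex Ψ Y y t) / π := by
  obtain ⟨σ, hσ, hv⟩ := h.exists_velocity_eq hM
  have hccw (v : ℂ) {u : ℝ} (hu : u ∈ Icc (0 : ℝ) 1) :
      ccwAngle v (velocity γ u) = ccwAngle v (I * γ u) := by
    obtain ⟨c, hc, hvu⟩ := hv u hu
    rw [← ccwAngle_real_mul_right (mul_ne_zero hc.ne' hσ) v (I * γ u), hvu]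
    push_cast
    ring_nf
  rw [pathDegree, intersectionIndex, intersectionIndex, hccw _ unitInterval.zero_mem,
    hccw _ unitInterval.one_mem, h.start, h.finish, ← sub_div, endIndex, endIndex]
  congr 1
  linarith [h.sub_eq_of_isGrading hη hM hg]

/-! ### Arcs that return to their boundary circle -/

lemma one_sub_eq_zero_or_one {s : ℝ} (hs : s = 0 ∨ s = 1) : 1 - s = 0 ∨ 1 - s = 1 := by
  rcases hs with rfl | rfl <;> simp

lemma mem_Icc_of_eq_zero_or_one {s : ℝ} (hs : s = 0 ∨ s = 1) : s ∈ Icc (0 : ℝ) 1 := by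
  rcases hs with rfl | rfl <;> simp

lemma eq_one_sub_of_ne {s s' : ℝ} (hs : s = 0 ∨ s = 1) (hs' : s' = 0 ∨ s' = 1) (hne : s ≠ s') :
    s' = 1 - s := by
  rcases hs with rfl | rfl <;> rcases hs' with rfl | rfl <;> simp at hne ⊢

lemma lineMap_mem_Icc {a b u : ℝ} (ha : a = 0 ∨ a = 1) (hb : b = 0 ∨ b = 1)
    (hu : u ∈ Icc (0 : ℝ) 1) : AffineMap.lineMap a b u ∈ Icc (0 : ℝ) 1 :=
  (convex_Icc 0 1).lineMap_mem (mem_Icc_of_eq_zero_or_one ha) (mem_Icc_of_eq_zero_or_one hb) hu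

/-- Otherwise the straight homotopy in the strip would deform the arc into the marking. -/
lemma IsArc.exists_notMem {M : Set ℂ} {r σ : ℝ} {X Γ G : ℝ → ℂ} (hX : IsArc M X)
    (h : IsStripLift r σ X Γ G) (hre : ∀ u, u = 0 ∨ u = 1 → (Γ u).re = 0) :
    ∃ θ ∈ uIcc (Γ 0).im (Γ 1).im, sideExp r σ (θ * I) ∉ M := by
  by_contra! hall
  have hΓ := h.continuous_lift
  have h0 : (Γ 0).re = 0 := hre 0 (Or.inl rfl)
  have h1 : (Γ 1).re = 0 := hre 1 (Or.inr rfl)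
  set H : ℝ × ℝ → ℂ := fun p =>
    AffineMap.lineMap (Γ p.2) (AffineMap.lineMap (Γ 0) (Γ 1) p.2 : ℂ) p.1 with hH
  have hchord (t : ℝ) : (AffineMap.lineMap (Γ 0) (Γ 1) t : ℂ) =
      (AffineMap.lineMap (Γ 0).im (Γ 1).im t : ℝ) * I := by
    apply Complex.ext <;> simp [AffineMap.lineMap_apply, h0, h1]
  refine hX.essential ⟨fun p => sideExp r σ (H p), ?_, fun a ha t ht => ?_, fun t ht => ?_,
    fun a _ => ⟨?_, ?_⟩, fun t ht => ?_⟩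
  · simp only [hH, sideExp, AffineMap.lineMap_apply_module]
    fun_prop
  · have hb := h.re_mem_Icc hX.toIsImmersedCurve ht
    have hre_eq : (H (a, t)).re = (1 - a) * (Γ t).re := by
      simp [hH, hchord, AffineMap.lineMap_apply_module]
    rw [h.side.sideExp_mem_annulus_iff, hre_eq]
    exact ⟨mul_nonneg (sub_nonneg.2 ha.2) hb.1,
      (mul_le_of_le_one_left hb.1 (sub_le_self 1 ha.1)).trans hb.2⟩
  · simp only [h.eq_sideExp t ht, hH, AffineMap.lineMap_apply_zero]
  · simpa only [hH, AffineMap.lineMap_apply_zero, AffineMap.lineMap_same_apply,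
      ← h.eq_sideExp 0 unitInterval.zero_mem] using hX.endpoints.1
  · simpa only [hH, AffineMap.lineMap_apply_one, AffineMap.lineMap_same_apply,
      ← h.eq_sideExp 1 unitInterval.one_mem] using hX.endpoints.2
  · simp only [hH, AffineMap.lineMap_apply_one, hchord]
    refine hall _ ?_
    rw [← segment_eq_uIcc, segment_eq_image_lineMap]
    exact mem_image_of_mem _ ht

lemma IsBoundaryPath.strictMonoOn_im {M : Set ℂ} {X Y γ Γ G : ℝ → ℂ}
    {r σ s t : ℝ} (hγ : IsBoundaryPath M X Y γ s t) (h : IsStripLift r σ γ Γ G)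
    (hnorm : ∀ u ∈ Icc (0 : ℝ) 1, ‖γ u‖ = r) : StrictMonoOn (fun u => (Γ u).im) (Icc 0 1) := by
  have hderiv (u : ℝ) : HasDerivAt (fun u => (Γ u).im) (G u).im u :=
    Complex.imCLM.hasFDerivAt.comp_hasDerivAt u (h.hasDerivAt u)
  refine strictMonoOn_of_deriv_pos (convex_Icc 0 1)
    (Complex.continuous_im.comp h.continuous_lift).continuousOn fun u hu => ?_
  replace hu := interior_subset hu
  obtain ⟨c, hc, hv⟩ := hγ.direction u hu
  rw [h.velocity_eq hu, h.side.reverseBoundary_eq (hnorm u hu)] at hv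
  have hσγ : (σ : ℂ) * γ u ≠ 0 :=
    mul_ne_zero (Complex.ofReal_ne_zero.2 h.side.ne_zero) (ne_zero_of_mem_annulus (hγ.mem u hu))
  have hG : G u = c * I := mul_left_cancel₀ hσγ (by linear_combination hv)
  rw [(hderiv u).deriv, hG]
  simpa using hc

lemma IsBoundaryPath.norm_eq {M : Set ℂ} (hM : IsMarking M) {X Y γ : ℝ → ℂ} {s t : ℝ}
    (h : IsBoundaryPath M X Y γ s t) : ‖X s‖ = ‖Y t‖ := by
  rw [← h.start, ← h.finish]
  exact hM.norm_eq_of_path h.smooth.continuousOn h.mem_marking unitInterval.zero_mem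
    unitInterval.one_mem

lemma IsBoundaryPath.exists_lift {M : Set ℂ} (hM : IsMarking M) {X Y γ : ℝ → ℂ} {s t : ℝ}
    (hγ : IsBoundaryPath M X Y γ s t) {r σ : ℝ} (hside : IsSide r σ) {w : ℂ}
    (hw : X s = sideExp r σ w) (hw0 : w.re = 0) :
    ∃ w' : ℂ, Y t = sideExp r σ w' ∧ w.im < w'.im ∧
      ∀ θ ∈ Icc w.im w'.im, sideExp r σ (θ * I) ∈ M := by
  have zero_mem : (0 : ℝ) ∈ Icc (0 : ℝ) 1 := unitInterval.zero_mem
  have one_mem : (1 : ℝ) ∈ Icc (0 : ℝ) 1 := unitInterval.one_mem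
  obtain ⟨Γ, G, h, rfl⟩ :=
    hγ.toIsImmersedCurve.exists_stripLift hside zero_mem (hγ.start.trans hw)
  have hnorm (u : ℝ) (hu : u ∈ Icc (0 : ℝ) 1) : ‖γ u‖ = r :=
    (hM.norm_eq_of_path hγ.smooth.continuousOn hγ.mem_marking hu zero_mem).trans
      ((h.norm_eq_iff zero_mem).2 hw0)
  refine ⟨Γ 1, by rw [← hγ.finish, h.eq_sideExp 1 one_mem],
    hγ.strictMonoOn_im h hnorm zero_mem one_mem zero_lt_one, fun θ hθ => ?_⟩
  obtain ⟨u, hu, rfl⟩ := intermediate_value_Icc zero_le_one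
    (Complex.continuous_im.comp h.continuous_lift).continuousOn hθ
  have hΓu : ((Γ u).im : ℂ) * I = Γ u := by
    apply Complex.ext <;> simp [(h.norm_eq_iff hu).1 (hnorm u hu)]
  rw [Function.comp_apply, hΓu, ← h.eq_sideExp u hu]
  exact hγ.mem_marking u hu

/-- Otherwise the ends of the lifts would interleave, because each arc has an unmarked point between
its ends, and the arcs would intersect. -/
lemma im_lt_im_of_forall_mem {M : Set ℂ} {r σ : ℝ} {X Y ΓX GX ΓY GY : ℝ → ℂ} {s t : ℝ}
    (hX : IsArc M X) (hY : IsArc M Y) (hdisj : Disjoint (X '' Icc 0 1) (Y '' Icc 0 1))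
    (hlX : IsStripLift r σ X ΓX GX) (hlY : IsStripLift r σ Y ΓY GY)
    (hreX : ∀ u, u = 0 ∨ u = 1 → (ΓX u).re = 0) (hreY : ∀ u, u = 0 ∨ u = 1 → (ΓY u).re = 0)
    (hs : s = 0 ∨ s = 1) (ht : t = 0 ∨ t = 1) (hlt : (ΓX s).im < (ΓX (1 - s)).im)
    (hst : (ΓX s).im < (ΓY t).im)
    (hmark : ∀ θ ∈ Icc (ΓX s).im (ΓY t).im, sideExp r σ (θ * I) ∈ M) :
    (ΓY t).im < (ΓY (1 - t)).im := by
  by_contra! hge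
  have hs' := one_sub_eq_zero_or_one hs
  have ht' := one_sub_eq_zero_or_one ht
  obtain ⟨θ₁, hθ₁, hM₁⟩ : ∃ θ ∈ Icc (ΓX s).im (ΓX (1 - s)).im, sideExp r σ (θ * I) ∉ M := by
    rw [← uIcc_of_le hlt.le]
    rcases hs with rfl | rfl
    · simpa only [sub_zero] using hX.exists_notMem hlX hreX
    · simpa only [sub_self, uIcc_comm (ΓX 1).im] using hX.exists_notMem hlX hreX
  obtain ⟨θ₂, hθ₂, hM₂⟩ : ∃ θ ∈ Icc (ΓY (1 - t)).im (ΓY t).im, sideExp r σ (θ * I) ∉ M := by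
    rw [← uIcc_of_le hge]
    rcases ht with rfl | rfl
    · simpa only [sub_zero, uIcc_comm (ΓY 1).im] using hY.exists_notMem hlY hreY
    · simpa only [sub_self] using hY.exists_notMem hlY hreY
  have hYX : (ΓY t).im < θ₁ := by
    by_contra! hle
    exact hM₁ (hmark θ₁ ⟨hθ₁.1, hle⟩)
  have hXY : θ₂ < (ΓX s).im := by
    by_contra! hle
    exact hM₂ (hmark θ₂ ⟨hle, hθ₂.2⟩)
  have hΓX := hlX.continuous_lift
  have hΓY := hlY.continuous_lift
  obtain ⟨a, ha, b, hb, hab⟩ := exists_eq_of_interleaved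
    (α := fun u => ΓY (AffineMap.lineMap (1 - t) t u))
    (β := fun u => ΓX (AffineMap.lineMap s (1 - s) u)) (by fun_prop) (by fun_prop)
    (fun u hu => (hlY.re_mem_Icc hY.toIsImmersedCurve (lineMap_mem_Icc ht' ht hu)).1)
    (fun u hu => (hlX.re_mem_Icc hX.toIsImmersedCurve (lineMap_mem_Icc hs hs' hu)).1)
    (by simpa using hreY _ ht') (by simpa using hreY _ ht) (by simpa using hreX _ hs)
    (by simpa using hreX _ hs') (by simpa using hθ₂.1.trans_lt hXY) (by simpa using hst)
    (by simpa using hYX.trans_le hθ₁.2)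
  refine Set.disjoint_left.1 hdisj ⟨_, lineMap_mem_Icc hs hs' hb, rfl⟩
    ⟨_, lineMap_mem_Icc ht' ht ha, ?_⟩
  rw [hlX.eq_sideExp _ (lineMap_mem_Icc hs hs' hb), hlY.eq_sideExp _ (lineMap_mem_Icc ht' ht ha)]
  exact congrArg _ hab

lemma IsBoundaryPath.endIndex_sub_eq {η : Foliation} {Ψ : ℂ → ℝ} (hη : IsGlobalAngle η Ψ)
    {M : Set ℂ} (hM : IsMarking M) {r σ : ℝ} {X Y γ Γ G : ℝ → ℂ} {s t : ℝ} (hX : IsArc M X)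
    (hY : IsArc M Y) (hdisj : Disjoint (X '' Icc 0 1) (Y '' Icc 0 1))
    (hγ : IsBoundaryPath M X Y γ s t) (h : IsStripLift r σ X Γ G)
    (hreX : ∀ u, u = 0 ∨ u = 1 → (Γ u).re = 0) (hnormY : ‖Y t‖ = ‖Y (1 - t)‖) {x y : ℝ → ℝ}
    (hx : IsGrading η X x) (hy : IsGrading η Y y) (hlt : (Γ s).im < (Γ (1 - s)).im) :
    endIndex Ψ X x (1 - s) - endIndex Ψ X x s = endIndex Ψ Y y (1 - t) - endIndex Ψ Y y t := by
  have hs := mem_Icc_of_eq_zero_or_one hγ.source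
  have ht := mem_Icc_of_eq_zero_or_one hγ.target
  obtain ⟨w, hw, hst, hmark⟩ := hγ.exists_lift hM h.side (h.eq_sideExp s hs) (hreX s hγ.source)
  obtain ⟨ΓY, GY, hlY, rfl⟩ := hY.toIsImmersedCurve.exists_stripLift h.side ht hw
  have hYt : ‖Y t‖ = r := (hγ.norm_eq hM).symm.trans ((h.norm_eq_iff hs).2 (hreX s hγ.source))
  have hreY (u : ℝ) (hu : u = 0 ∨ u = 1) : (ΓY u).re = 0 := by
    refine (hlY.norm_eq_iff (mem_Icc_of_eq_zero_or_one hu)).1 ?_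
    by_cases htu : t = u
    · rwa [← htu]
    · rw [eq_one_sub_of_ne hγ.target hu htu, ← hnormY, hYt]
  have hltY := im_lt_im_of_forall_mem hX hY hdisj h hlY hreX hreY hγ.source hγ.target hlt hst hmark
  rw [endIndex_eq_of_returning hη h hX hreX hx hγ.source hlt,
    endIndex_eq_of_returning hη hlY hY hreY hy hγ.target hltY]
  ring

lemma IsDoublePair.endIndex_sub_eq_of_returning {η : Foliation} {Ψ : ℂ → ℝ}
    (hη : IsGlobalAngle η Ψ) {M : Set ℂ} (hM : IsMarking M) {X Y γ γ' : ℝ → ℂ} {s t : ℝ}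
    (hp : IsDoublePair M X Y γ γ' s t (1 - s) (1 - t)) (hnorm : ‖X s‖ = ‖X (1 - s)‖)
    {x y : ℝ → ℝ} (hx : IsGrading η X x) (hy : IsGrading η Y y) :
    endIndex Ψ X x (1 - s) - endIndex Ψ X x s = endIndex Ψ Y y (1 - t) - endIndex Ψ Y y t := by
  have hX := hp.arc_left
  have hs := mem_Icc_of_eq_zero_or_one hp.path.source
  have hs' := mem_Icc_of_eq_zero_or_one hp.path'.source
  have hnormY : ‖Y t‖ = ‖Y (1 - t)‖ := by rw [← hp.path.norm_eq hM, hnorm, hp.path'.norm_eq hM]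
  obtain ⟨r, σ, hside, hγ⟩ := hp.path.exists_isSide hM
  have hXs : ‖X s‖ = r := by rw [← hp.path.start, hγ 0 unitInterval.zero_mem]
  obtain ⟨w, hw⟩ := hside.exists_sideExp_eq (ne_zero_of_mem_annulus (hX.mem s hs))
  obtain ⟨Γ, G, h, -⟩ := hX.toIsImmersedCurve.exists_stripLift hside hs hw.symm
  have hre (u : ℝ) (hu : u = 0 ∨ u = 1) : (Γ u).re = 0 := by
    refine (h.norm_eq_iff (mem_Icc_of_eq_zero_or_one hu)).1 ?_
    by_cases hsu : s = u
    · rwa [← hsu]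
    · rw [eq_one_sub_of_ne hp.path.source hu hsu, ← hnorm, hXs]
  have hne : (Γ s).im ≠ (Γ (1 - s)).im := fun him => by
    have : s = 1 - s := h.injOn hX.injOn hs hs'
      (Complex.ext ((hre s hp.path.source).trans (hre _ hp.path'.source).symm) him)
    rcases hp.path.source with rfl | rfl <;> norm_num at this
  rcases hne.lt_or_gt with hlt | hlt
  · exact hp.path.endIndex_sub_eq hη hM hX hp.arc_right hp.disjoint h hre hnormY hx hy hlt
  · have := hp.path'.endIndex_sub_eq hη hM hX hp.arc_right hp.disjoint h hre
      (by rw [sub_sub_cancel, hnormY]) hx hy (by rwa [sub_sub_cancel])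
    rw [sub_sub_cancel, sub_sub_cancel] at this
    linarith

lemma IsAngle.isBalanced {η : Foliation} {ψ : ℂ → ℝ} (h : IsAngle η ψ 0) {M : Set ℂ}
    (hM : IsMarking M) : IsBalanced M η := by
  intro X Y γ γ' s t s' t' hp x y g g' hx hy hg hg'
  have hη := h.isGlobalAngle
  rw [pathDegree_eq hη hM hp.path x y hg, pathDegree_eq hη hM hp.path' x y hg']
  by_cases hss : s = s'
  · rw [hss, hp.loop.1 hss]
  obtain rfl := eq_one_sub_of_ne hp.path.source hp.path'.source hss
  obtain rfl := eq_one_sub_of_ne hp.path.target hp.path'.target (mt hp.loop.2 hss)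
  congr 1
  by_cases hXn : ‖X s‖ = ‖X (1 - s)‖
  · linarith [hp.endIndex_sub_eq_of_returning hη hM hXn hx hy]
  · have hYn : ‖Y t‖ ≠ ‖Y (1 - t)‖ := by rwa [← hp.path.norm_eq hM, ← hp.path'.norm_eq hM]
    rw [endIndex_eq_of_crossing hη hM hp.arc_left hp.path.source hXn hx,
      endIndex_eq_of_crossing hη hM hp.arc_right hp.path.target hYn hy]

end AnnulusFoliation

theorem mainTheorem8 :
    ∃ c : AnnulusFoliation.FoliationClass,
      (∀ M : Set ℂ, AnnulusFoliation.IsMarking M → ∀ η : AnnulusFoliation.Foliation,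
        AnnulusFoliation.IsBalanced M η ↔ AnnulusFoliation.Foliation.toClass η = c) ∧
      (∀ η : AnnulusFoliation.Foliation,
        AnnulusFoliation.WindsTrivially η ↔ AnnulusFoliation.Foliation.toClass η = c) ∧
      (∀ η : AnnulusFoliation.Foliation,
        AnnulusFoliation.HasDegree (AnnulusFoliation.Foliation.circleMap η) 0 ↔
          AnnulusFoliation.Foliation.toClass η = c) := by
  refine ⟨AnnulusFoliation.circleFoliation.toClass, fun M hM η => ?_, fun η => ?_, fun η => ?_⟩
  all_goals
    obtain ⟨ψ, d, h⟩ := AnnulusFoliation.exists_isAngle η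
    rw [h.toClass_eq_iff]
  · exact ⟨h.eq_zero_of_isBalanced hM, by rintro rfl; exact h.isBalanced hM⟩
  · exact ⟨h.eq_zero_of_windsTrivially, by rintro rfl; exact h.windsTrivially⟩
  · exact ⟨h.hasDegree.unique, by rintro rfl; exact h.hasDegree⟩
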